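/- **Proposition (constant term of the Quicksort moments).** Let $Z$ be distributed according to the Quicksort limit law, i.e. the centred law with finite variance satisfying $$Z \overset{d}{=} U Z_1+(1-U)Z_2+C(U),\qquad C(x)=1+2x\ln x+2(1-x)\ln(1-x),$$ where $Z_1,Z_2$ are copies of $Z$, $U$ is uniform on $[0,1]$, and $U,Z_1,Z_2$ are independent. Put $\mu_s=\mathbb E(Z^s)$. Formal expression of the moments. Let $\mathbb Q[z_2,z_3,\dots]$ be the polynomial ring in variables $z_k$ standing for $\zeta(k)$. For $a,b\ge1$ let $\zeta_{a,b}$ (an expression of the multiple zeta value $\zeta(a+1,\{1\}_{b-1})$) be the coefficient of $x^ay^b$ in $1-\exp\big(\sum_{k\ge2}\frac{x^k+y^k-(x+y)^k}{k}z_k\big)$. For $n,m,i\ge 0$ define $S_{n,m}^{(i)}\in\mathbb Q[z_2,z_3,\dots]$ (an expression of $\frac{(-1)^{n+m}}{n!\,m!}\int_0^1x^i\ln^n(x)\ln^m(1-x)\,dx$) by $S_{0,m}^{(i)}=\frac1{i+1}\zeta^\star_{i+1}(\{1\}_m)$, $S_{n,0}^{(i)}=\frac1{(i+1)^{n+1}}$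 and, for $n,m\ge1$, $$S_{n,m}^{(i)}=\tfrac1{i+1}\Big[S_{n-1,m}^{(i)}+\sum_{j=0}^iS_{n,m-1}^{(j)}-\zeta_{n,m}\Big].$$ Define $P_s\in\mathbb Q[z_2,z_3,\dots]$ by $P_0=1$, $P_1=0$ and, for $s\ge2$, $$P_s=\frac{s+1}{s-1}\sum_{\substack{k_1+k_2+k_3=s\\k_1,k_2<s}}\binom{s}{k_1,k_2,k_3}P_{k_1}P_{k_2}\,J_{k_1,k_2,k_3},$$ where $$J_{k_1,k_2,k_3}=\sum_{n+m+p=k_3}\sum_{j=0}^{m+k_2}\binom{k_3}{n,m,p}\binom{m+k_2}{j}(-1)^j2^{n+m}(-1)^{n+m}n!\,m!\,S_{n,m}^{(n+k_1+j)}$$ is the corresponding expression of $\int_0^1x^{k_1}(1-x)^{k_2}C(x)^{k_3}dx$. Let $c_s\in\mathbb Q$ be the constant term of $P_s$. The binomial coefficients of tier $i$ are $$(n,m)_i=\frac1{i+1}\sum_{k=0}^n(-1)^k\binom{n-k+m}{m}\zeta_i(\{1\}_k)\,\zeta^\star_{i+1}(\{1\}_{n-k+m}),$$ where $\zeta_N(\{1\}_k)=\sum_{N\ge\ell_1>\dots>\ell_k\ge1}\frac1{\ell_1\cdots\ell_k}$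 and $\zeta^\star_N(\{1\}_k)=\sum_{N\ge\ell_1\ge\dots\ge\ell_k\ge1}\frac1{\ell_1\cdots\ell_k}$ (both equal to $1$ for $k=0$). Then: 1. For every $s\ge0$ the moment $\mu_s$ exists and $\mu_s=P_s(\zeta(2),\zeta(3),\dots)$. 2. If every $Q\in\mathbb Q[z_2,z_3,\dots]$ with $Q(\zeta(2),\zeta(3),\dots)=0$ has constant term $0$ (so that the constant term of a number is well defined), then every $Q\in\mathbb Q[z_2,z_3,\dots]$ with $Q(\zeta(2),\zeta(3),\dots)=\mu_s$ has constant term $c_s$. 3. $c_0=1$, $c_1=0$, and for all $s\ge2$ $$c_s=\frac{s+1}{s-1}\sum_{\substack{k_1+k_2+k_3=s\\k_1,k_2<s}}\binom{s}{k_1,k_2,k_3}c_{k_1}c_{k_2}\sum_{n+m+p=k_3}\sum_{j=0}^{m+k_2}\binom{k_3}{n,m,p}\binom{m+k_2}{j}(-1)^j2^{n+m}(-1)^{n+m}n!\,m!\,(n,m)_{n+k_1+j}.$$ -/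

import Mathlib

/-- Truncated multiple zeta value
`ζ_n(i₁, …, i_k) = ∑_{n ≥ ℓ₁ > ⋯ > ℓ_k ≥ 1} 1 / (ℓ₁ ^ i₁ ⋯ ℓ_k ^ i_k)`. -/
def truncMZV : List ℕ → ℕ → ℚ
  | [], _ => 1
  | a :: l, n => ∑ r ∈ Finset.Icc 1 n, 1 / (r : ℚ) ^ a * truncMZV l (r - 1)

/-- Truncated multiple zeta star value
`ζ*_n(i₁, …, i_k) = ∑_{n ≥ ℓ₁ ≥ ⋯ ≥ ℓ_k ≥ 1} 1 / (ℓ₁ ^ i₁ ⋯ ℓ_k ^ i_k)`. -/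
def truncMZSV : List ℕ → ℕ → ℚ
  | [], _ => 1
  | a :: l, n => ∑ r ∈ Finset.Icc 1 n, 1 / (r : ℚ) ^ a * truncMZSV l r

/-- The binomial coefficient `(n, m)_i` of tier `i`. -/
def tieredBinom (n m i : ℕ) : ℚ :=
  1 / ((i : ℚ) + 1) * ∑ k ∈ Finset.range (n + 1),
    (-1) ^ k * ((n - k + m).choose m : ℚ) *
      truncMZV (List.replicate k 1) i * truncMZSV (List.replicate (n - k + m) 1) (i + 1)

/-- Rational polynomials in the zeta values; the variable `X k` stands for `ζ(k + 2)`. -/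
abbrev ZetaPoly : Type := MvPolynomial ℕ ℚ

/-- The value of a rational polynomial in `ζ(2), ζ(3), …`. -/
noncomputable def zetaEval : ZetaPoly →ₐ[ℚ] ℂ :=
  MvPolynomial.aeval (fun k : ℕ => riemannZeta ((k : ℂ) + 2))

/-- `∑_{2 ≤ k ≤ d} (x ^ k + y ^ k - (x + y) ^ k) / k * ζ(k)`, a polynomial in `x = X 0` and
`y = X 1` with coefficients in the rational polynomials in the zeta values. -/
noncomputable def zetaExponent (d : ℕ) : MvPolynomial (Fin 2) ZetaPoly :=
  ∑ k ∈ Finset.Icc 2 d,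
    MvPolynomial.C (MvPolynomial.C (1 / (k : ℚ)) * MvPolynomial.X (k - 2)) *
      (MvPolynomial.X 0 ^ k + MvPolynomial.X 1 ^ k - (MvPolynomial.X 0 + MvPolynomial.X 1) ^ k)

/-- For `a, b ≥ 1`, the multiple zeta value `ζ(a + 1, {1}_{b - 1})` as a rational polynomial in the
zeta values: the coefficient of `x ^ a * y ^ b` in
`1 - exp (∑_{k ≥ 2} (x ^ k + y ^ k - (x + y) ^ k) / k * ζ(k))`.
Terms of the exponent with `k > a + b`, and terms of the exponential series beyond the power
`a + b`, do not contribute to this coefficient. -/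
noncomputable def heightOneMZVPoly (a b : ℕ) : ZetaPoly :=
  -MvPolynomial.coeff (Finsupp.single (0 : Fin 2) a + Finsupp.single (1 : Fin 2) b)
    (∑ j ∈ Finset.range (a + b + 1),
      MvPolynomial.C (MvPolynomial.C (1 / (j.factorial : ℚ))) * zetaExponent (a + b) ^ j)

/-- The normalized logarithmic integral
`S n m i = (-1) ^ (n + m) / (n! m!) * ∫₀¹ x ^ i * (log x) ^ n * (log (1 - x)) ^ m dx`
as a rational polynomial in the zeta values. It is computed from the boundary values
`S 0 m i = ζ*_{i+1}({1}_m) / (i + 1)`, `S n 0 i = 1 / (i + 1) ^ (n + 1)` by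
`S n m i = (S (n-1) m i + ∑_{j ≤ i} S n (m-1) j - ζ(n + 1, {1}_{m-1})) / (i + 1)`. -/
noncomputable def logIntegralPoly : ℕ → ℕ → ℕ → ZetaPoly
  | 0, m, i => MvPolynomial.C (1 / ((i : ℚ) + 1) * truncMZSV (List.replicate m 1) (i + 1))
  | n + 1, 0, i => MvPolynomial.C (1 / ((i : ℚ) + 1) ^ (n + 2))
  | n + 1, m + 1, i =>
      MvPolynomial.C (1 / ((i : ℚ) + 1)) *
        (logIntegralPoly n (m + 1) i + ∑ j ∈ Finset.range (i + 1), logIntegralPoly (n + 1) m j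
          - heightOneMZVPoly (n + 1) (m + 1))
  termination_by n m _ => n + m

/-- The toll function `C(x) = 1 + 2 x log x + 2 (1 - x) log (1 - x)`. -/
noncomputable def quicksortToll (x : ℝ) : ℝ :=
  1 + 2 * x * Real.log x + 2 * (1 - x) * Real.log (1 - x)

/-- The integral `∫₀¹ x ^ a * (1 - x) ^ b * C(x) ^ c dx` as a rational polynomial in the zeta
values: `C(x) ^ c` is expanded by the multinomial theorem, with `q 0`, `q 1`, `q 2` the exponents of
`2 x log x`, `2 (1 - x) log (1 - x)` and `1`, then the power of `1 - x` by the binomial theorem. -/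
noncomputable def tollIntegralPoly (a b c : ℕ) : ZetaPoly :=
  ∑ q ∈ Finset.Nat.antidiagonalTuple 3 c, ∑ j ∈ Finset.range (q 1 + b + 1),
    MvPolynomial.C ((Nat.multinomial Finset.univ q : ℚ) * ((q 1 + b).choose j : ℚ) * (-1) ^ j *
        2 ^ (q 0 + q 1) * ((-1) ^ (q 0 + q 1) * ((q 0).factorial : ℚ) * ((q 1).factorial : ℚ))) *
      logIntegralPoly (q 0) (q 1) (q 0 + a + j)

/-- The expression of the moment `μ_s` of the Quicksort limit law as a rational polynomial in the
zeta values, obtained from the recurrence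
`μ_s = (s + 1) / (s - 1) * ∑ (s choose k₁, k₂, k₃) * μ_{k₁} * μ_{k₂} *
  ∫₀¹ x ^ k₁ * (1 - x) ^ k₂ * C(x) ^ k₃ dx`, the sum being over `k₁ + k₂ + k₃ = s` with
`k₁, k₂ < s`, for `s ≥ 2`. -/
noncomputable def momentPoly : ℕ → ZetaPoly
  | 0 => 1
  | 1 => 0
  | t + 2 =>
      MvPolynomial.C (((t : ℚ) + 3) / ((t : ℚ) + 1)) *
        ∑ k ∈ Finset.Nat.antidiagonalTuple 3 (t + 2),
          if h : k 0 < t + 2 ∧ k 1 < t + 2 then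
            MvPolynomial.C (Nat.multinomial Finset.univ k : ℚ) *
              momentPoly (k 0) * momentPoly (k 1) * tollIntegralPoly (k 0) (k 1) (k 2)
          else 0
  termination_by s => s
  decreasing_by
    · exact h.1
    · exact h.2

/-- `ν` is the Quicksort limit law: the centred probability law with finite variance that solves
`Z = U Z₁ + (1 - U) Z₂ + C(U)` in distribution, where `Z₁, Z₂` are copies of `Z`, `U` is uniformly
distributed on `[0, 1]`, and `U, Z₁, Z₂` are independent. -/
structure IsQuicksortLimitLaw (ν : MeasureTheory.Measure ℝ) : Prop where
  isProbabilityMeasure : MeasureTheory.IsProbabilityMeasure ν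
  memLp_two : MeasureTheory.MemLp (fun z : ℝ => z) 2 ν
  mean_eq_zero : ∫ z, z ∂ν = 0
  fixed_point :
    ν = MeasureTheory.Measure.map
      (fun p : ℝ × ℝ × ℝ => p.1 * p.2.1 + (1 - p.1) * p.2.2 + quicksortToll p.1)
      ((MeasureTheory.volume.restrict (Set.Icc (0 : ℝ) 1)).prod (ν.prod ν))

/-! The `s`-th power of the fixed point equation is expanded by the multinomial theorem, and
independence factors each expectation into two moments and a toll integral. The two terms that
contain `μ_s` itself carry `∫ u ^ s = ∫ (1 - u) ^ s = 1 / (s + 1)`; solving for `μ_s` gives the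
factor `(s + 1) / (s - 1)` (`IsQuicksortLimitLaw.moment_recurrence`). Two analytic facts remain: all
moments are finite, and the logarithmic integrals obey the recurrence that defines
`logIntegralPoly`.

Finiteness is a bootstrap from the variance. One factor of `|z| ^ (n + 3)` is truncated at `K`; the
fixed point equation bounds the truncated moment `E` by `2 / (n + 3) * E` plus a constant that
involves only moments of order `n + 2`. Since `2 / (n + 3) < 1`, this bounds `E` uniformly in `K`
(`exists_integral_truncPow_le`), and `K → ∞` by monotone convergence.

For the integrals, integration by parts (`logIntegral_recurrence`) reduces the recurrence to `i =
0`. Formally the generating series at level `i` is the Beta value `B(i + 1 - x, 1 - y)`, and the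
claim at `i = 0` reads `(1 - x - y) B(1 - x, 1 - y) = Γ(1 - x) Γ(1 - y) / Γ(1 - x - y) = exp (∑ (x ^
k + y ^ k - (x + y) ^ k) ζ(k) / k)`. It is proved coefficientwise. Iterating the Beta recursion
writes the left side as a remainder times `gammaProd N` (`shiftedLogSeries_zero_eq`). This finite
product is the exponential with `ζ(k)` replaced by its partial sums
(`coeff_truncExp_eq_coeff_gammaProd`), and the remainder tends to `1`
(`tendsto_coeff_shiftedLogSeries_mul_linearProd`).

The constant term is a ring homomorphism that annihilates every `ζ_{n,m}` with `n, m ≥ 1`. Without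
that term the recurrence for the integrals is the one satisfied by the binomial coefficients of tier
`i` (`tieredBinom_succ_succ`), so the recurrence for `c_s` is the image of the one for `P_s`.
Uniqueness of the constant term follows by applying the hypothesis to `Q - P_s`. -/

/-! ### Constant terms and the binomial coefficients of tier `i`. -/

/-- Every term of the exponent has a variable as a factor, so taking constant terms turns the
exponential into `1`, which has no monomial of positive degree. -/
theorem constantCoeff_heightOneMZVPoly {a b : ℕ} (hab : 0 < a + b) :
    MvPolynomial.constantCoeff (heightOneMZVPoly a b) = 0 := by
  have hexp : MvPolynomial.map (MvPolynomial.constantCoeff : ZetaPoly →+* ℚ)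
      (zetaExponent (a + b)) = 0 := by
    simp [zetaExponent]
  have hne : (Finsupp.single (0 : Fin 2) a + Finsupp.single (1 : Fin 2) b) ≠ 0 := by
    intro h
    have h0 := DFunLike.congr_fun h 0
    have h1 := DFunLike.congr_fun h 1
    simp at h0 h1
    omega
  rw [heightOneMZVPoly, map_neg, ← MvPolynomial.coeff_map, map_sum, Finset.sum_range_succ']
  simp [hexp, MvPolynomial.coeff_one, hne.symm]

theorem truncMZV_replicate_succ (k N : ℕ) :
    truncMZV (List.replicate (k + 1) 1) (N + 1) =
      truncMZV (List.replicate (k + 1) 1) N +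
        1 / ((N : ℚ) + 1) * truncMZV (List.replicate k 1) N := by
  simp [List.replicate_succ, truncMZV, Finset.sum_Icc_succ_top]

theorem truncMZSV_replicate_succ (k N : ℕ) :
    truncMZSV (List.replicate (k + 1) 1) (N + 1) =
      truncMZSV (List.replicate (k + 1) 1) N +
        1 / ((N : ℚ) + 1) * truncMZSV (List.replicate k 1) (N + 1) := by
  simp [List.replicate_succ, truncMZSV, Finset.sum_Icc_succ_top]

theorem truncMZV_replicate_zero_right (k : ℕ) :
    truncMZV (List.replicate k 1) 0 = if k = 0 then 1 else 0 := by
  cases k <;> simp [List.replicate_succ, truncMZV]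

theorem truncMZSV_replicate_zero_right (k : ℕ) :
    truncMZSV (List.replicate k 1) 0 = if k = 0 then 1 else 0 := by
  cases k <;> simp [List.replicate_succ, truncMZSV]

/-- The coefficient of `x ^ n * y ^ m` in
`∏_{l ≤ M} (1 - x / l) / ∏_{l ≤ N} (1 - (x + y) / l)`. -/
def mixedBinom (M N n m : ℕ) : ℚ :=
  ∑ k ∈ Finset.range (n + 1),
    (-1) ^ k * ((n - k + m).choose m : ℚ) *
      truncMZV (List.replicate k 1) M * truncMZSV (List.replicate (n - k + m) 1) N

theorem tieredBinom_eq (n m i : ℕ) :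
    tieredBinom n m i = 1 / ((i : ℚ) + 1) * mixedBinom i (i + 1) n m := rfl

/-- Coefficientwise form of multiplying the generating product by `1 - x / (M + 1)`. -/
theorem mixedBinom_succ_left (M N n m : ℕ) :
    mixedBinom (M + 1) N (n + 1) m =
      mixedBinom M N (n + 1) m - 1 / ((M : ℚ) + 1) * mixedBinom M N n m := by
  simp only [mixedBinom]
  rw [Finset.sum_range_succ' _ (n + 1), Finset.sum_range_succ' _ (n + 1), Finset.mul_sum]
  simp only [truncMZV_replicate_succ, Nat.add_sub_add_right]
  simp only [List.replicate_zero, truncMZV]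
  rw [add_sub_right_comm, ← Finset.sum_sub_distrib]
  congr 1
  refine Finset.sum_congr rfl fun k _ => ?_
  ring

theorem mixedBinom_zero_left (M N m : ℕ) :
    mixedBinom M N 0 m = truncMZSV (List.replicate m 1) N := by
  simp [mixedBinom, truncMZV]

/-- Dividing by `1 - (x + y) / (N + 1)` gives `F_{N+1} = F_N + (x + y) / (N + 1) * F_{N+1}`. On
coefficients this is Pascal's rule, applied termwise. -/
theorem mixedBinom_succ_right (M N n m : ℕ) :
    mixedBinom M (N + 1) (n + 1) (m + 1) =
      mixedBinom M N (n + 1) (m + 1) + 1 / ((N : ℚ) + 1) *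
        (mixedBinom M (N + 1) n (m + 1) + mixedBinom M (N + 1) (n + 1) m) := by
  simp only [mixedBinom]
  rw [Finset.sum_range_succ _ (n + 1), Finset.sum_range_succ _ (n + 1),
    Finset.sum_range_succ (fun k => (-1) ^ k * ((n + 1 - k + m).choose m : ℚ) * _ * _) (n + 1)]
  have key : ∀ k ∈ Finset.range (n + 1),
      (-1) ^ k * ((n + 1 - k + (m + 1)).choose (m + 1) : ℚ) *
        truncMZV (List.replicate k 1) M *
          truncMZSV (List.replicate (n + 1 - k + (m + 1)) 1) (N + 1) =
      (-1) ^ k * ((n + 1 - k + (m + 1)).choose (m + 1) : ℚ) *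
        truncMZV (List.replicate k 1) M *
          truncMZSV (List.replicate (n + 1 - k + (m + 1)) 1) N +
      1 / ((N : ℚ) + 1) * ((-1) ^ k * ((n - k + (m + 1)).choose (m + 1) : ℚ) *
        truncMZV (List.replicate k 1) M *
          truncMZSV (List.replicate (n - k + (m + 1)) 1) (N + 1) +
        (-1) ^ k * ((n + 1 - k + m).choose m : ℚ) *
        truncMZV (List.replicate k 1) M *
          truncMZSV (List.replicate (n + 1 - k + m) 1) (N + 1)) := by
    intro k hk
    have hk' : k ≤ n := by simpa [Nat.lt_succ_iff] using hk
    obtain ⟨r, rfl⟩ := Nat.exists_eq_add_of_le hk'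
    have h1 : k + r + 1 - k = r + 1 := by omega
    have h2 : k + r - k = r := by omega
    rw [h1, h2, show r + 1 + (m + 1) = r + 1 + m + 1 by ring, truncMZSV_replicate_succ,
      show r + (m + 1) = r + 1 + m by ring, Nat.choose_succ_succ]
    push_cast
    ring
  rw [Finset.sum_congr rfl key, Finset.sum_add_distrib, ← Finset.mul_sum, Finset.sum_add_distrib,
    Nat.sub_self, zero_add, zero_add, truncMZSV_replicate_succ]
  simp only [Nat.choose_self, Nat.cast_one]
  ring

theorem mixedBinom_succ_right_zero (M N n : ℕ) :
    mixedBinom M (N + 1) (n + 1) 0 =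
      mixedBinom M N (n + 1) 0 + 1 / ((N : ℚ) + 1) * mixedBinom M (N + 1) n 0 := by
  simp only [mixedBinom]
  rw [Finset.sum_range_succ _ (n + 1), Finset.sum_range_succ _ (n + 1), add_right_comm,
    Finset.mul_sum, ← Finset.sum_add_distrib]
  congr 1
  · refine Finset.sum_congr rfl fun k hk => ?_
    have hk' : k ≤ n := by simpa [Nat.lt_succ_iff] using hk
    rw [Nat.succ_sub hk']
    simp only [Nat.succ_eq_add_one, Nat.add_zero, Nat.choose_zero_right]
    rw [truncMZSV_replicate_succ]
    ring
  · simp [truncMZSV]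

/-- At `y = 0` and `M = N` the two products cancel. -/
theorem mixedBinom_self_zero (N n : ℕ) : mixedBinom N N (n + 1) 0 = 0 := by
  induction N with
  | zero =>
    simp only [mixedBinom, truncMZV_replicate_zero_right, truncMZSV_replicate_zero_right]
    refine Finset.sum_eq_zero fun k _ => ?_
    rcases eq_or_ne k 0 with rfl | hk <;> simp [*]
  | succ N ih =>
    rw [mixedBinom_succ_left, mixedBinom_succ_right_zero, ih]
    ring

theorem mixedBinom_zero_zero (n m : ℕ) : mixedBinom 0 0 (n + 1) (m + 1) = 0 := by
  simp only [mixedBinom, truncMZV_replicate_zero_right, truncMZSV_replicate_zero_right]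
  refine Finset.sum_eq_zero fun k _ => ?_
  simp

theorem tieredBinom_zero_left (m i : ℕ) :
    tieredBinom 0 m i = 1 / ((i : ℚ) + 1) * truncMZSV (List.replicate m 1) (i + 1) := by
  rw [tieredBinom_eq, mixedBinom_zero_left]

theorem tieredBinom_zero_right (n i : ℕ) : tieredBinom n 0 i = 1 / ((i : ℚ) + 1) ^ (n + 1) := by
  induction n with
  | zero => simp [tieredBinom, truncMZV, truncMZSV]
  | succ n ih =>
    rw [tieredBinom_eq] at ih ⊢
    rw [mixedBinom_succ_right_zero, mixedBinom_self_zero, ih, pow_succ _ (n + 1)]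
    field_simp
    ring

/-- Telescoping: with `F` the series for `(N, N + 1)`, the diagonal increment is `(1 - x / (N + 1))
F - (1 - (x + y) / (N + 1)) F = y / (N + 1) * F`, whose coefficients are the binomials of tier `N`.
-/
theorem mixedBinom_self_eq_sum (N n m : ℕ) :
    mixedBinom N N (n + 1) (m + 1) = ∑ j ∈ Finset.range N, tieredBinom (n + 1) m j := by
  induction N with
  | zero => simp [mixedBinom_zero_zero]
  | succ N ih =>
    rw [Finset.sum_range_succ, ← ih, mixedBinom_succ_left, mixedBinom_succ_right, tieredBinom_eq]
    ring

theorem tieredBinom_succ_succ (n m i : ℕ) :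
    tieredBinom (n + 1) (m + 1) i = 1 / ((i : ℚ) + 1) *
      (tieredBinom n (m + 1) i + ∑ j ∈ Finset.range (i + 1), tieredBinom (n + 1) m j) := by
  rw [← mixedBinom_self_eq_sum, mixedBinom_succ_left, tieredBinom_eq, tieredBinom_eq]
  ring

theorem constantCoeff_logIntegralPoly (n m i : ℕ) :
    MvPolynomial.constantCoeff (logIntegralPoly n m i) = tieredBinom n m i := by
  induction n generalizing m i with
  | zero => rw [logIntegralPoly, MvPolynomial.constantCoeff_C, tieredBinom_zero_left]
  | succ n ihn =>
    induction m generalizing i with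
    | zero => rw [logIntegralPoly, MvPolynomial.constantCoeff_C, tieredBinom_zero_right]
    | succ m ihm =>
      rw [logIntegralPoly, map_mul, map_sub, map_add, map_sum, MvPolynomial.constantCoeff_C,
        constantCoeff_heightOneMZVPoly (by omega), ihn, sub_zero, tieredBinom_succ_succ]
      simp only [ihm]

theorem constantCoeff_tollIntegralPoly (a b c : ℕ) :
    MvPolynomial.constantCoeff (tollIntegralPoly a b c) =
      ∑ q ∈ Finset.Nat.antidiagonalTuple 3 c, ∑ j ∈ Finset.range (q 1 + b + 1),
        (Nat.multinomial Finset.univ q : ℚ) * ((q 1 + b).choose j : ℚ) *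
          (-1) ^ j * 2 ^ (q 0 + q 1) * (-1) ^ (q 0 + q 1) *
          ((q 0).factorial : ℚ) * ((q 1).factorial : ℚ) * tieredBinom (q 0) (q 1) (q 0 + a + j) := by
  simp only [tollIntegralPoly, map_sum, map_mul, MvPolynomial.constantCoeff_C,
    constantCoeff_logIntegralPoly]
  refine Finset.sum_congr rfl fun q _ => Finset.sum_congr rfl fun j _ => ?_
  ring

theorem momentPoly_of_two_le {s : ℕ} (hs : 2 ≤ s) :
    momentPoly s = MvPolynomial.C (((s : ℚ) + 1) / ((s : ℚ) - 1)) *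
      ∑ k ∈ (Finset.Nat.antidiagonalTuple 3 s).filter (fun k => k 0 < s ∧ k 1 < s),
        MvPolynomial.C (Nat.multinomial Finset.univ k : ℚ) *
          momentPoly (k 0) * momentPoly (k 1) * tollIntegralPoly (k 0) (k 1) (k 2) := by
  obtain ⟨t, rfl⟩ := Nat.exists_eq_add_of_le' hs
  rw [momentPoly, Finset.sum_filter]
  push_cast
  congr 3
  · ring
  · ring

theorem constantCoeff_momentPoly {s : ℕ} (hs : 2 ≤ s) :
    MvPolynomial.constantCoeff (momentPoly s) = ((s : ℚ) + 1) / ((s : ℚ) - 1) *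
      ∑ k ∈ (Finset.Nat.antidiagonalTuple 3 s).filter (fun k => k 0 < s ∧ k 1 < s),
        (Nat.multinomial Finset.univ k : ℚ) * MvPolynomial.constantCoeff (momentPoly (k 0)) *
          MvPolynomial.constantCoeff (momentPoly (k 1)) *
          ∑ q ∈ Finset.Nat.antidiagonalTuple 3 (k 2), ∑ j ∈ Finset.range (q 1 + k 1 + 1),
            (Nat.multinomial Finset.univ q : ℚ) * ((q 1 + k 1).choose j : ℚ) *
              (-1) ^ j * 2 ^ (q 0 + q 1) * (-1) ^ (q 0 + q 1) *
              ((q 0).factorial : ℚ) * ((q 1).factorial : ℚ) *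
              tieredBinom (q 0) (q 1) (q 0 + k 0 + j) := by
  rw [momentPoly_of_two_le hs]
  simp only [map_mul, map_sum, MvPolynomial.constantCoeff_C, constantCoeff_tollIntegralPoly]

/-! ### Logarithmic integrals: integrability and integration by parts. -/

/-- The normalized logarithmic power `(-log x) ^ n / n!`. -/
noncomputable def logPow (n : ℕ) (x : ℝ) : ℝ := (-Real.log x) ^ n / n.factorial

/-- The integral `(-1) ^ (n + m) / (n! m!) * ∫₀¹ x ^ i * (log x) ^ n * (log (1 - x)) ^ m dx`. -/
noncomputable def logIntegral (n m i : ℕ) : ℝ :=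
  ∫ x in (0 : ℝ)..1, x ^ i * logPow n x * logPow m (1 - x)

@[simp] theorem logPow_zero (x : ℝ) : logPow 0 x = 1 := by simp [logPow]

theorem logPow_one_right (n : ℕ) : logPow (n + 1) 1 = 0 := by simp [logPow]

theorem logPow_nonneg (n : ℕ) {x : ℝ} (h0 : 0 ≤ x) (h1 : x ≤ 1) : 0 ≤ logPow n x :=
  div_nonneg (pow_nonneg (neg_nonneg.2 (Real.log_nonpos h0 h1)) _) (Nat.cast_nonneg _)

theorem logPow_sq (n : ℕ) (x : ℝ) :
    logPow n x ^ 2 = ((2 * n).factorial / (n.factorial : ℝ) ^ 2) * logPow (2 * n) x := by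
  have h1 := (2 * n).factorial_ne_zero
  have h2 := n.factorial_ne_zero
  simp only [logPow]
  field_simp
  ring

theorem hasDerivAt_logPow (n : ℕ) {x : ℝ} (hx : x ≠ 0) :
    HasDerivAt (logPow (n + 1)) (-logPow n x / x) x := by
  have h := (((Real.hasDerivAt_log hx).neg).pow (n + 1)).div_const ((n + 1).factorial : ℝ)
  refine h.congr_deriv ?_
  have h2 : (n.factorial : ℝ) ≠ 0 := by exact_mod_cast n.factorial_ne_zero
  have h3 : (n : ℝ) + 1 ≠ 0 := by positivity
  simp only [logPow, Nat.factorial_succ, Nat.cast_mul, Nat.cast_add, Nat.cast_one,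
    Nat.add_sub_cancel, Pi.neg_apply]
  field_simp

theorem hasDerivAt_logPow_one_sub (n : ℕ) {x : ℝ} (hx : x ≠ 1) :
    HasDerivAt (fun y => logPow (n + 1) (1 - y)) (logPow n (1 - x) / (1 - x)) x := by
  have h := (hasDerivAt_logPow n (sub_ne_zero.2 hx.symm)).comp x
    ((hasDerivAt_id x).const_sub 1)
  refine h.congr_deriv ?_
  ring

theorem measurable_logPow (n : ℕ) : Measurable (logPow n) :=
  (Real.measurable_log.neg.pow_const n).div_const _

/-- With `r = n + 1` and `t = x ^ (1 / r)` one has `x * (-log x) ^ (n + 1) = (-(r * (t * log t))) ^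
(n + 1)`, which reduces to the continuity of `t * log t`. -/
theorem continuousOn_mul_logPow (n : ℕ) :
    ContinuousOn (fun x : ℝ => x * logPow n x) (Set.Icc 0 1) := by
  rcases n with _ | n
  · simp only [logPow_zero, mul_one]
    exact continuousOn_id
  set r : ℝ := (n : ℝ) + 1 with hr
  have hr0 : 0 < r := by positivity
  have hc : Continuous fun x : ℝ =>
      (-(r * (x ^ (1 / r) * Real.log (x ^ (1 / r))))) ^ (n + 1) / ((n + 1).factorial : ℝ) := by
    have h1 : Continuous fun x : ℝ => x ^ (1 / r) := Real.continuous_rpow_const (by positivity)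
    exact (((continuous_const.mul (Real.continuous_mul_log.comp h1)).neg).pow _).div_const _
  refine hc.continuousOn.congr fun x hx => ?_
  rcases hx.1.eq_or_lt with h | h
  · rw [← h]
    beta_reduce
    rw [Real.zero_rpow (one_div_pos.2 hr0).ne']
    simp
  · have h2 : (x ^ (1 / r)) ^ (n + 1) = x := by
      rw [← Real.rpow_natCast, ← Real.rpow_mul h.le]
      simp [hr, show (n : ℝ) + 1 ≠ 0 by positivity]
    have h3 : -(r * (x ^ (1 / r) * Real.log (x ^ (1 / r)))) = x ^ (1 / r) * (-Real.log x) := by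
      rw [Real.log_rpow h]
      field_simp
    simp only [logPow]
    rw [h3, mul_pow, h2, mul_div_assoc]

theorem intervalIntegrable_logPow (n : ℕ) :
    IntervalIntegrable (logPow n) MeasureTheory.volume 0 1 := by
  -- This choice gives `t * n ≤ 1 / 2`, so `|log x| * x ^ t < 1 / t` bounds `|log x| ^ n` by a
  -- multiple of the integrable `x ^ (-1 / 2)`.
  set t : ℝ := 1 / (2 * ((n : ℝ) + 1)) with ht
  have ht0 : 0 < t := by positivity
  have hi : IntervalIntegrable (fun x : ℝ => (1 / t) ^ n * x ^ (-(1 / 2) : ℝ))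
      MeasureTheory.volume 0 1 :=
    (intervalIntegral.intervalIntegrable_rpow' (by norm_num)).const_mul _
  refine hi.mono_fun (measurable_logPow n).aestronglyMeasurable ?_
  rw [Filter.EventuallyLE, MeasureTheory.ae_restrict_iff' measurableSet_uIoc]
  refine Filter.Eventually.of_forall fun x hx => ?_
  rw [Set.uIoc_of_le zero_le_one] at hx
  have h1 := (Real.abs_log_mul_self_rpow_lt x t hx.1 hx.2 ht0).le
  have h2 : |Real.log x| ^ n * x ^ (t * n) ≤ (1 / t) ^ n := by
    have := pow_le_pow_left₀ (abs_nonneg _) h1 n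
    rw [abs_mul, abs_of_pos (Real.rpow_pos_of_pos hx.1 t), mul_pow] at this
    rwa [Real.rpow_mul hx.1.le, Real.rpow_natCast]
  have h3 : x ^ (1 / 2 : ℝ) ≤ x ^ (t * n) := by
    refine Real.rpow_le_rpow_of_exponent_ge hx.1 hx.2 ?_
    rw [ht, div_mul_eq_mul_div, div_le_div_iff₀ (by positivity) (by norm_num)]
    linarith
  have h4 : |Real.log x| ^ n * x ^ (1 / 2 : ℝ) ≤ (1 / t) ^ n :=
    (mul_le_mul_of_nonneg_left h3 (by positivity)).trans h2
  have h5 : 0 < x ^ (1 / 2 : ℝ) := Real.rpow_pos_of_pos hx.1 _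
  rw [Real.norm_eq_abs, Real.norm_eq_abs, logPow, abs_div, abs_pow, abs_neg, Nat.abs_cast,
    abs_of_nonneg (mul_nonneg (by positivity) (Real.rpow_nonneg hx.1.le _)),
    Real.rpow_neg hx.1.le, ← div_eq_mul_inv]
  refine (div_le_self (by positivity) ?_).trans ((le_div_iff₀ h5).2 h4)
  exact_mod_cast n.factorial_pos

theorem intervalIntegrable_logPow_one_sub (n : ℕ) :
    IntervalIntegrable (fun x => logPow n (1 - x)) MeasureTheory.volume 0 1 := by
  simpa using ((intervalIntegrable_logPow n).comp_sub_left 1).symm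

theorem intervalIntegrable_logIntegrand (n m i : ℕ) :
    IntervalIntegrable (fun x => x ^ i * logPow n x * logPow m (1 - x))
      MeasureTheory.volume 0 1 := by
  set A : ℝ := (2 * n).factorial / (n.factorial : ℝ) ^ 2
  set B : ℝ := (2 * m).factorial / (m.factorial : ℝ) ^ 2
  have hi : IntervalIntegrable (fun x => A * logPow (2 * n) x + B * logPow (2 * m) (1 - x))
      MeasureTheory.volume 0 1 :=
    ((intervalIntegrable_logPow _).const_mul _).add
      ((intervalIntegrable_logPow_one_sub _).const_mul _)
  refine hi.mono_fun ?_ ?_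
  · exact (((measurable_id.pow_const i).mul (measurable_logPow n)).mul
      ((measurable_logPow m).comp (measurable_const.sub measurable_id))).aestronglyMeasurable
  rw [Filter.EventuallyLE, MeasureTheory.ae_restrict_iff' measurableSet_uIoc]
  refine Filter.Eventually.of_forall fun x hx => ?_
  rw [Set.uIoc_of_le zero_le_one] at hx
  have ha := logPow_nonneg n hx.1.le hx.2
  have hb := logPow_nonneg m (sub_nonneg.2 hx.2) (sub_le_self 1 hx.1.le)
  have hx1 : x ^ i ≤ 1 := pow_le_one₀ hx.1.le hx.2
  rw [← logPow_sq, ← logPow_sq, Real.norm_of_nonneg (by have := hx.1; positivity),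
    Real.norm_of_nonneg (by positivity)]
  have h1 : x ^ i * logPow n x * logPow m (1 - x) ≤ logPow n x * logPow m (1 - x) := by
    rw [mul_assoc]
    exact mul_le_of_le_one_left (mul_nonneg ha hb) hx1
  -- The product of the two logarithmic powers is at most the sum of their squares, and these are
  -- again logarithmic powers by `logPow_sq`.
  nlinarith [sq_nonneg (logPow n x - logPow m (1 - x)), mul_nonneg ha hb]

theorem logIntegral_nonneg (n m i : ℕ) : 0 ≤ logIntegral n m i := by
  refine intervalIntegral.integral_nonneg zero_le_one fun x hx => ?_
  exact mul_nonneg (mul_nonneg (pow_nonneg hx.1 _) (logPow_nonneg _ hx.1 hx.2))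
    (logPow_nonneg _ (sub_nonneg.2 hx.2) (sub_le_self 1 hx.1))

theorem continuousOn_logPrimitive (n m i : ℕ) :
    ContinuousOn (fun x : ℝ => x ^ (i + 1) * (1 - x) * logPow n x * logPow m (1 - x))
      (Set.Icc 0 1) := by
  have h1 := continuousOn_mul_logPow n
  have h2 : ContinuousOn (fun x : ℝ => (1 - x) * logPow m (1 - x)) (Set.Icc 0 1) := by
    refine (continuousOn_mul_logPow m).comp (f := fun x : ℝ => 1 - x)
      (continuousOn_const.sub continuousOn_id) fun x hx => ?_
    exact ⟨sub_nonneg.2 hx.2, sub_le_self 1 hx.1⟩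
  refine (((continuousOn_id.pow i).mul h1).mul h2).congr fun x _ => ?_
  simp only [id, Pi.mul_apply, Pi.pow_apply]
  ring

/-- The derivative of `x ^ (i + 1) * (1 - x) * logPow (n + 1) x * logPow (m + 1) (1 - x)` integrates
to zero; the polynomial factors make the primitive continuous at both ends. The identity says that
`(i + 1) S_{n+1,m+1}^{(i)} - S_{n,m+1}^{(i)} - ∑_{j ≤ i} S_{n+1,m}^{(j)}` does not depend on `i`. -/
theorem logIntegral_recurrence (n m i : ℕ) :
    ((i : ℝ) + 2) * logIntegral (n + 1) (m + 1) (i + 1) - logIntegral n (m + 1) (i + 1)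
        - logIntegral (n + 1) m (i + 1) =
      ((i : ℝ) + 1) * logIntegral (n + 1) (m + 1) i - logIntegral n (m + 1) i := by
  have hI := intervalIntegrable_logIntegrand
  have h := intervalIntegral.integral_eq_sub_of_hasDerivAt_of_le zero_le_one
    (continuousOn_logPrimitive (n + 1) (m + 1) i)
    (f' := fun x => ((i : ℝ) + 1) * (x ^ i * logPow (n + 1) x * logPow (m + 1) (1 - x))
      - ((i : ℝ) + 2) * (x ^ (i + 1) * logPow (n + 1) x * logPow (m + 1) (1 - x))
      - x ^ i * logPow n x * logPow (m + 1) (1 - x)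
      + x ^ (i + 1) * logPow n x * logPow (m + 1) (1 - x)
      + x ^ (i + 1) * logPow (n + 1) x * logPow m (1 - x)) ?_ ?_
  · rw [intervalIntegral.integral_add, intervalIntegral.integral_add,
      intervalIntegral.integral_sub, intervalIntegral.integral_sub,
      intervalIntegral.integral_const_mul, intervalIntegral.integral_const_mul] at h
    · simp only [sub_self, mul_zero, zero_mul, ne_eq, Nat.add_eq_zero_iff, one_ne_zero, and_false,
        not_false_eq_true, zero_pow] at h
      simp only [logIntegral]
      linarith
    all_goals
      first
      | exact hI _ _ _
      | exact (hI _ _ _).const_mul _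
      | exact ((hI _ _ _).const_mul _).sub ((hI _ _ _).const_mul _)
      | exact (((hI _ _ _).const_mul _).sub ((hI _ _ _).const_mul _)).sub (hI _ _ _)
      | exact ((((hI _ _ _).const_mul _).sub ((hI _ _ _).const_mul _)).sub (hI _ _ _)).add
          (hI _ _ _)
  · intro x hx
    have hx0 : x ≠ 0 := hx.1.ne'
    have hx1 : x ≠ 1 := hx.2.ne
    have hx2 : 1 - x ≠ 0 := sub_ne_zero.2 hx1.symm
    have h := (((hasDerivAt_pow (i + 1) x).mul ((hasDerivAt_id x).const_sub 1)).mul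
      (hasDerivAt_logPow n hx0)).mul (hasDerivAt_logPow_one_sub m hx1)
    refine h.congr_deriv ?_
    simp only [Pi.mul_apply, id, Nat.add_sub_cancel, Nat.cast_add, Nat.cast_one]
    field_simp
    ring
  · exact (((((hI _ _ _).const_mul _).sub ((hI _ _ _).const_mul _)).sub (hI _ _ _)).add
      (hI _ _ _)).add (hI _ _ _)

theorem logIntegral_recurrence_zero_left (m i : ℕ) :
    ((i : ℝ) + 2) * logIntegral 0 (m + 1) (i + 1) =
      ((i : ℝ) + 1) * logIntegral 0 (m + 1) i + logIntegral 0 m (i + 1) := by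
  have hI := intervalIntegrable_logIntegrand
  have h := intervalIntegral.integral_eq_sub_of_hasDerivAt_of_le zero_le_one
    (continuousOn_logPrimitive 0 (m + 1) i)
    (f' := fun x => ((i : ℝ) + 1) * (x ^ i * logPow 0 x * logPow (m + 1) (1 - x))
      - ((i : ℝ) + 2) * (x ^ (i + 1) * logPow 0 x * logPow (m + 1) (1 - x))
      + x ^ (i + 1) * logPow 0 x * logPow m (1 - x)) ?_ ?_
  · rw [intervalIntegral.integral_add, intervalIntegral.integral_sub,
      intervalIntegral.integral_const_mul, intervalIntegral.integral_const_mul] at h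
    · simp only [sub_self, mul_zero, zero_mul, ne_eq, Nat.add_eq_zero_iff, one_ne_zero, and_false,
        not_false_eq_true, zero_pow] at h
      simp only [logIntegral]
      linarith
    all_goals
      first
      | exact hI _ _ _
      | exact (hI _ _ _).const_mul _
      | exact ((hI _ _ _).const_mul _).sub ((hI _ _ _).const_mul _)
  · intro x hx
    have hx1 : x ≠ 1 := hx.2.ne
    have hx2 : 1 - x ≠ 0 := sub_ne_zero.2 hx1.symm
    have h := ((hasDerivAt_pow (i + 1) x).mul ((hasDerivAt_id x).const_sub 1)).mul
      (hasDerivAt_logPow_one_sub m hx1)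
    simp only [logPow_zero, mul_one]
    refine h.congr_deriv ?_
    simp only [Pi.mul_apply, id, Nat.add_sub_cancel, Nat.cast_add, Nat.cast_one]
    field_simp
    ring
  · exact (((hI _ _ _).const_mul _).sub ((hI _ _ _).const_mul _)).add (hI _ _ _)

theorem logIntegral_succ_zero_right (n i : ℕ) :
    ((i : ℝ) + 1) * logIntegral (n + 1) 0 i = logIntegral n 0 i := by
  have hI := intervalIntegrable_logIntegrand
  have hc : ContinuousOn (fun x : ℝ => x ^ (i + 1) * logPow (n + 1) x) (Set.Icc 0 1) := by
    refine ((continuousOn_id.pow i).mul (continuousOn_mul_logPow (n + 1))).congr fun x _ => ?_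
    simp only [id, Pi.mul_apply, Pi.pow_apply]
    ring
  have h := intervalIntegral.integral_eq_sub_of_hasDerivAt_of_le zero_le_one hc
    (f' := fun x => ((i : ℝ) + 1) * (x ^ i * logPow (n + 1) x * logPow 0 (1 - x))
      - x ^ i * logPow n x * logPow 0 (1 - x)) ?_ ?_
  · rw [intervalIntegral.integral_sub ((hI _ _ _).const_mul _) (hI _ _ _),
      intervalIntegral.integral_const_mul, logPow_one_right] at h
    simp only [mul_zero, zero_mul, ne_eq, Nat.add_eq_zero_iff, one_ne_zero, and_false,
      not_false_eq_true, zero_pow] at h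
    simp only [logIntegral]
    linarith
  · intro x hx
    have hx0 : x ≠ 0 := hx.1.ne'
    refine ((hasDerivAt_pow (i + 1) x).mul (hasDerivAt_logPow n hx0)).congr_deriv ?_
    simp only [logPow_zero, mul_one, Nat.add_sub_cancel, Nat.cast_add, Nat.cast_one]
    field_simp
    ring
  · exact ((hI _ _ _).const_mul _).sub (hI _ _ _)

theorem logIntegral_zero_zero (i : ℕ) : logIntegral 0 0 i = 1 / ((i : ℝ) + 1) := by
  simp [logIntegral]

theorem logIntegral_zero_right (n i : ℕ) : logIntegral n 0 i = 1 / ((i : ℝ) + 1) ^ (n + 1) := by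
  induction n with
  | zero => simp [logIntegral_zero_zero]
  | succ n ih =>
    have h := logIntegral_succ_zero_right n i
    have h1 : (i : ℝ) + 1 ≠ 0 := by positivity
    rw [ih] at h
    rw [eq_div_iff (by positivity), pow_succ, mul_comm, mul_assoc, h]
    field_simp

theorem logIntegral_swap (n m : ℕ) : logIntegral n m 0 = logIntegral m n 0 := by
  have h := intervalIntegral.integral_comp_sub_left (a := 0) (b := 1)
    (fun x => x ^ 0 * logPow n x * logPow m (1 - x)) (1 : ℝ)
  simp only [sub_zero, sub_self, sub_sub_cancel, pow_zero, one_mul] at h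
  simp only [logIntegral, pow_zero, one_mul]
  rw [← h]
  exact intervalIntegral.integral_congr fun x _ => mul_comm _ _

theorem logIntegral_zero_left (m i : ℕ) :
    logIntegral 0 m i = 1 / ((i : ℝ) + 1) * (truncMZSV (List.replicate m 1) (i + 1) : ℚ) := by
  induction m generalizing i with
  | zero => simp [logIntegral_zero_zero, truncMZSV]
  | succ m ihm =>
    have h0 : ∀ i : ℕ, (i : ℝ) + 1 ≠ 0 := fun i => by positivity
    induction i with
    | zero =>
      have : ∀ k, truncMZSV (List.replicate k 1) 1 = 1 := by
        intro k
        induction k with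
        | zero => simp [truncMZSV]
        | succ k ih => simpa [List.replicate_succ, truncMZSV] using ih
      rw [logIntegral_swap, logIntegral_zero_right, zero_add, this]
      simp
    | succ i ih =>
      have h := logIntegral_recurrence_zero_left m i
      rw [ih, ihm, ← mul_assoc, mul_one_div_cancel (h0 i)] at h
      rw [truncMZSV_replicate_succ]
      push_cast at h ⊢
      have h2 : (i : ℝ) + 1 + 1 ≠ 0 := by positivity
      rw [one_div_mul_eq_div, eq_div_iff h2, mul_comm]
      rw [show (i : ℝ) + 1 + 1 = i + 2 by ring] at h ⊢
      rw [h]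
      ring

/-! ### Decay of the logarithmic integrals as `i → ∞`. -/

theorem harmonic_mono : Monotone harmonic :=
  monotone_nat_of_le_succ fun n => by
    rw [harmonic_succ]
    exact le_add_of_nonneg_right (by positivity)

theorem truncMZSV_replicate_le (k N : ℕ) :
    truncMZSV (List.replicate k 1) N ≤ harmonic N ^ k := by
  induction k generalizing N with
  | zero => simp [truncMZSV]
  | succ k ih =>
    rw [pow_succ', harmonic_eq_sum_Icc, Finset.sum_mul, ← harmonic_eq_sum_Icc]
    refine Finset.sum_le_sum fun r hr => ?_
    rw [pow_one, one_div]
    refine mul_le_mul_of_nonneg_left ((ih _).trans ?_) (by positivity)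
    have h0 : 0 ≤ harmonic r := Finset.sum_nonneg fun _ _ => by positivity
    exact pow_le_pow_left₀ h0 (harmonic_mono (Finset.mem_Icc.1 hr).2) _

theorem logIntegral_le (n m : ℕ) : ∃ C : ℝ, ∀ i : ℕ,
    logIntegral n m i ≤ C * ((harmonic (i + 1) : ℚ) : ℝ) ^ (2 * m) / ((i : ℝ) + 1) ^ (n + 1) := by
  set A : ℝ := (2 * n).factorial / (n.factorial : ℝ) ^ 2 with hA
  set B : ℝ := (2 * m).factorial / (m.factorial : ℝ) ^ 2 with hB
  have hA0 : 0 ≤ A := by positivity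
  have hB0 : 0 ≤ B := by positivity
  refine ⟨A + B, fun i => ?_⟩
  -- Weight for `a * b ≤ w * a ^ 2 + b ^ 2 / w`: it gives both resulting integrals the same power
  -- `(i + 1) ^ (-(n + 1))`, up to harmonic factors.
  set w : ℝ := ((i : ℝ) + 1) ^ n with hw
  have hi0 : (0 : ℝ) < (i : ℝ) + 1 := by positivity
  have hw0 : 0 < w := by positivity
  have hI := intervalIntegrable_logIntegrand
  have h1 : logIntegral n m i ≤ w * A * logIntegral (2 * n) 0 i +
      B / w * logIntegral 0 (2 * m) i := by
    simp only [logIntegral]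
    rw [← intervalIntegral.integral_const_mul, ← intervalIntegral.integral_const_mul,
      ← intervalIntegral.integral_add ((hI _ _ _).const_mul _) ((hI _ _ _).const_mul _)]
    refine intervalIntegral.integral_mono_on zero_le_one (hI _ _ _)
      (((hI _ _ _).const_mul _).add ((hI _ _ _).const_mul _)) fun x hx => ?_
    have ha := logPow_nonneg n hx.1 hx.2
    have hb := logPow_nonneg m (sub_nonneg.2 hx.2) (sub_le_self 1 hx.1)
    have hx0 : 0 ≤ x ^ i := pow_nonneg hx.1 i
    have e1 : w * A * (x ^ i * logPow (2 * n) x * logPow 0 (1 - x)) +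
        B / w * (x ^ i * logPow 0 x * logPow (2 * m) (1 - x)) =
        x ^ i * (w * logPow n x ^ 2 + logPow m (1 - x) ^ 2 / w) := by
      rw [logPow_sq, logPow_sq, logPow_zero, logPow_zero]
      ring
    rw [e1, mul_assoc]
    refine mul_le_mul_of_nonneg_left ?_ hx0
    have h2 : 0 ≤ (w * logPow n x - logPow m (1 - x)) ^ 2 / w := by positivity
    have h3 : (w * logPow n x - logPow m (1 - x)) ^ 2 / w =
        w * logPow n x ^ 2 - 2 * (logPow n x * logPow m (1 - x)) + logPow m (1 - x) ^ 2 / w := by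
      field_simp
      ring
    nlinarith [mul_nonneg ha hb]
  set H : ℝ := ((harmonic (i + 1) : ℚ) : ℝ) with hH
  have hH1 : 1 ≤ H := by
    have : harmonic 1 ≤ harmonic (i + 1) := harmonic_mono (by omega)
    rw [hH]
    exact_mod_cast (by simpa [harmonic] using this)
  have h4 : ((truncMZSV (List.replicate (2 * m) 1) (i + 1) : ℚ) : ℝ) ≤ H ^ (2 * m) := by
    rw [hH]
    exact_mod_cast truncMZSV_replicate_le (2 * m) (i + 1)
  have h5 : (1 : ℝ) ≤ H ^ (2 * m) := one_le_pow₀ hH1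
  rw [logIntegral_zero_right, logIntegral_zero_left] at h1
  refine h1.trans ?_
  have e2 : w * A * (1 / ((i : ℝ) + 1) ^ (2 * n + 1)) = A * 1 / ((i : ℝ) + 1) ^ (n + 1) := by
    rw [hw, show 2 * n + 1 = n + (n + 1) by ring, pow_add _ n (n + 1)]
    field_simp
  have e3 : ∀ z : ℝ, B / w * (1 / ((i : ℝ) + 1) * z) = B * z / ((i : ℝ) + 1) ^ (n + 1) := by
    intro z
    rw [hw, pow_succ]
    field_simp
  rw [e2, e3, ← add_div, add_mul]
  gcongr

theorem tendsto_harmonic_pow_div (k : ℕ) :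
    Filter.Tendsto (fun i : ℕ => ((harmonic (i + 1) : ℚ) : ℝ) ^ k / ((i : ℝ) + 1))
      Filter.atTop (nhds 0) := by
  -- Used at `x = e * (i + 1)`, where `log x = 1 + log (i + 1)` is the standard upper bound for the
  -- harmonic number.
  have h1 : Filter.Tendsto (fun x : ℝ => Real.log x ^ k / (Real.exp (-1) * x + 0)) Filter.atTop
      (nhds 0) := Real.tendsto_pow_log_div_mul_add_atTop _ 0 k (Real.exp_pos _).ne'
  have h2 : Filter.Tendsto (fun i : ℕ => Real.exp 1 * ((i : ℝ) + 1)) Filter.atTop Filter.atTop :=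
    (Filter.tendsto_atTop_add_const_right _ _ tendsto_natCast_atTop_atTop).const_mul_atTop
      (Real.exp_pos 1)
  refine squeeze_zero (fun i => ?_) (fun i => ?_) (h1.comp h2)
  · have : 0 ≤ harmonic (i + 1) := Finset.sum_nonneg fun _ _ => by positivity
    have : (0 : ℝ) ≤ ((harmonic (i + 1) : ℚ) : ℝ) := by exact_mod_cast this
    positivity
  · have hi : (0 : ℝ) < (i : ℝ) + 1 := by positivity
    have h3 := harmonic_le_one_add_log (i + 1)
    push_cast at h3
    have h0 : 0 ≤ harmonic (i + 1) := Finset.sum_nonneg fun _ _ => by positivity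
    have h0' : (0 : ℝ) ≤ ((harmonic (i + 1) : ℚ) : ℝ) := by exact_mod_cast h0
    simp only [Function.comp]
    rw [Real.log_mul (Real.exp_pos 1).ne' hi.ne', Real.log_exp, ← mul_assoc, ← Real.exp_add]
    simp only [neg_add_cancel, Real.exp_zero, one_mul, add_zero]
    gcongr

theorem tendsto_logIntegral_mul (n m k : ℕ) :
    Filter.Tendsto (fun i : ℕ => ((i : ℝ) + 1) ^ n * logIntegral n m i *
      ((harmonic (i + 1) : ℚ) : ℝ) ^ k) Filter.atTop (nhds 0) := by
  obtain ⟨C, hC⟩ := logIntegral_le n m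
  have h := (tendsto_harmonic_pow_div (2 * m + k)).const_mul C
  rw [mul_zero] at h
  have h0 : ∀ i : ℕ, (0 : ℝ) ≤ ((harmonic (i + 1) : ℚ) : ℝ) := fun i => by
    exact_mod_cast (Finset.sum_nonneg fun _ _ => by positivity : 0 ≤ harmonic (i + 1))
  refine squeeze_zero (fun i => ?_) (fun i => ?_) h
  · exact mul_nonneg (mul_nonneg (by positivity) (logIntegral_nonneg _ _ _)) (pow_nonneg (h0 i) _)
  · have h1 := mul_le_mul_of_nonneg_right
      (mul_le_mul_of_nonneg_left (hC i) (by positivity : 0 ≤ ((i : ℝ) + 1) ^ n))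
      (pow_nonneg (h0 i) k)
    refine h1.trans (le_of_eq ?_)
    rw [pow_succ _ n, pow_add]
    field_simp

/-! ### Bivariate power series and the Euler derivation. -/

/-- Bivariate formal power series with real coefficients. -/
abbrev BiSeries : Type := MvPowerSeries (Fin 2) ℝ

/-- The exponent of the monomial `x ^ a * y ^ b`. -/
noncomputable def biExp (a b : ℕ) : Fin 2 →₀ ℕ := Finsupp.single 0 a + Finsupp.single 1 b

@[simp] theorem biExp_apply_zero (a b : ℕ) : biExp a b 0 = a := by simp [biExp]

@[simp] theorem biExp_apply_one (a b : ℕ) : biExp a b 1 = b := by simp [biExp]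

theorem eq_biExp (n : Fin 2 →₀ ℕ) : n = biExp (n 0) (n 1) := by
  ext i
  fin_cases i <;> simp

theorem degree_biExp (a b : ℕ) : (biExp a b).degree = a + b := by
  simp [biExp, Finsupp.degree_single]

theorem biExp_succ_left (a b : ℕ) : biExp (a + 1) b = biExp a b + Finsupp.single 0 1 := by
  ext i
  fin_cases i <;> simp [biExp]

theorem biExp_succ_right (a b : ℕ) : biExp a (b + 1) = biExp a b + Finsupp.single 1 1 := by
  ext i
  fin_cases i <;> simp [biExp]

theorem coeff_add_single_X_mul (s : Fin 2) (n : Fin 2 →₀ ℕ) (f : BiSeries) :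
    MvPowerSeries.coeff (n + Finsupp.single s 1) (MvPowerSeries.X s * f) =
      MvPowerSeries.coeff n f := by
  rw [add_comm, MvPowerSeries.X, MvPowerSeries.coeff_add_monomial_mul, one_mul]

theorem coeff_X_mul_of_eq_zero {s : Fin 2} {n : Fin 2 →₀ ℕ} (h : n s = 0) (f : BiSeries) :
    MvPowerSeries.coeff n (MvPowerSeries.X s * f) = 0 := by
  classical
  rw [MvPowerSeries.X, MvPowerSeries.coeff_monomial_mul, if_neg]
  intro hle
  have := hle s
  simp [h] at this

theorem coeff_biExp_X_zero_mul_succ (a b : ℕ) (f : BiSeries) :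
    MvPowerSeries.coeff (biExp (a + 1) b) (MvPowerSeries.X 0 * f) =
      MvPowerSeries.coeff (biExp a b) f := by
  rw [biExp_succ_left, coeff_add_single_X_mul]

theorem coeff_biExp_X_one_mul_succ (a b : ℕ) (f : BiSeries) :
    MvPowerSeries.coeff (biExp a (b + 1)) (MvPowerSeries.X 1 * f) =
      MvPowerSeries.coeff (biExp a b) f := by
  rw [biExp_succ_right, coeff_add_single_X_mul]

theorem coeff_biExp_X_zero_mul_zero (b : ℕ) (f : BiSeries) :
    MvPowerSeries.coeff (biExp 0 b) (MvPowerSeries.X 0 * f) = 0 :=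
  coeff_X_mul_of_eq_zero (biExp_apply_zero _ _) f

theorem coeff_biExp_X_one_mul_zero (a : ℕ) (f : BiSeries) :
    MvPowerSeries.coeff (biExp a 0) (MvPowerSeries.X 1 * f) = 0 :=
  coeff_X_mul_of_eq_zero (biExp_apply_one _ _) f

/-- The Euler derivation `x ∂/∂x + y ∂/∂y`. -/
noncomputable def eulerDeriv : Derivation ℝ BiSeries BiSeries :=
  (MvPowerSeries.X 0 : BiSeries) • MvPowerSeries.pderiv ℝ 0 +
    (MvPowerSeries.X 1 : BiSeries) • MvPowerSeries.pderiv ℝ 1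

theorem coeff_X_mul_pderiv (s : Fin 2) (n : Fin 2 →₀ ℕ) (f : BiSeries) :
    MvPowerSeries.coeff n (MvPowerSeries.X s * MvPowerSeries.pderiv ℝ s f) =
      n s * MvPowerSeries.coeff n f := by
  by_cases h : n s = 0
  · rw [coeff_X_mul_of_eq_zero h, h, Nat.cast_zero, zero_mul]
  · obtain ⟨m, rfl⟩ : ∃ m, n = m + Finsupp.single s 1 := by
      refine ⟨n - Finsupp.single s 1, (tsub_add_cancel_of_le ?_).symm⟩
      rw [Finsupp.single_le_iff]
      omega
    rw [coeff_add_single_X_mul, MvPowerSeries.coeff_pderiv]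
    simp [mul_comm]

theorem coeff_eulerDeriv (n : Fin 2 →₀ ℕ) (f : BiSeries) :
    MvPowerSeries.coeff n (eulerDeriv f) = (n.degree : ℝ) * MvPowerSeries.coeff n f := by
  have h : n.degree = n 0 + n 1 := by
    conv_lhs => rw [eq_biExp n]
    exact degree_biExp _ _
  rw [h]
  simp only [eulerDeriv, Derivation.add_apply, Derivation.smul_apply, smul_eq_mul, map_add,
    coeff_X_mul_pderiv]
  push_cast
  ring

theorem eulerDeriv_C (r : ℝ) : eulerDeriv (MvPowerSeries.C r : BiSeries) = 0 := by
  simp [eulerDeriv]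

theorem eulerDeriv_X (s : Fin 2) :
    eulerDeriv (MvPowerSeries.X s : BiSeries) = MvPowerSeries.X s := by
  fin_cases s <;> simp [eulerDeriv]

theorem eulerDeriv_pow {u : BiSeries} (hu : eulerDeriv u = u) (k : ℕ) :
    eulerDeriv (u ^ k) = (k : BiSeries) * u ^ k := by
  rcases k with _ | k
  · simp
  · rw [Derivation.leibniz_pow, hu, Nat.add_sub_cancel, smul_eq_mul, nsmul_eq_mul, pow_succ]

theorem eulerDeriv_C_mul (r : ℝ) (f : BiSeries) :
    eulerDeriv (MvPowerSeries.C r * f) = MvPowerSeries.C r * eulerDeriv f := by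
  rw [Derivation.leibniz, eulerDeriv_C, smul_zero, add_zero, smul_eq_mul]

/-- A solution of a homogeneous first order Euler equation with vanishing constant term vanishes, up
to the degree to which the equation holds. -/
theorem coeff_eq_zero_of_eulerDeriv {d : ℕ} {a h r : BiSeries}
    (ha : MvPowerSeries.constantCoeff a = 0) (hh : MvPowerSeries.constantCoeff h = 0)
    (he : eulerDeriv h = a * h + r) (hr : ∀ n, n.degree ≤ d → MvPowerSeries.coeff n r = 0) :
    ∀ n, n.degree ≤ d → MvPowerSeries.coeff n h = 0 := by
  classical
  intro n
  induction hk : n.degree using Nat.strong_induction_on generalizing n with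
  | _ k ih =>
    subst hk
    intro hn
    by_cases h0 : n = 0
    · rw [h0]
      exact hh
    have h1 := congrArg (MvPowerSeries.coeff n) he
    rw [coeff_eulerDeriv, map_add, hr n hn, add_zero, MvPowerSeries.coeff_mul,
      Finset.sum_eq_zero] at h1
    · exact (mul_eq_zero.1 h1).resolve_left
        (Nat.cast_ne_zero.2 ((Finsupp.degree_eq_zero_iff n).not.2 h0))
    · intro p hp
      rw [Finset.HasAntidiagonal.mem_antidiagonal] at hp
      by_cases hp0 : p.1 = 0
      · rw [hp0]
        exact mul_eq_zero_of_left ha _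
      · have h2 : n.degree = p.1.degree + p.2.degree := by rw [← hp, map_add]
        have h3 : p.1.degree ≠ 0 := (Finsupp.degree_eq_zero_iff _).not.2 hp0
        rw [ih p.2.degree (by omega) p.2 rfl (by omega), mul_zero]

theorem coeff_eq_zero_of_dvd {d : ℕ} {u f : BiSeries} (hu : MvPowerSeries.constantCoeff u = 0)
    (hf : u ^ (d + 1) ∣ f) {n : Fin 2 →₀ ℕ} (hn : n.degree ≤ d) :
    MvPowerSeries.coeff n f = 0 := by
  obtain ⟨g, rfl⟩ := hf
  refine MvPowerSeries.coeff_of_lt_order ?_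
  have h1 := MvPowerSeries.le_order_pow_of_constantCoeff_eq_zero (d + 1) hu
  have h2 : ((d + 1 : ℕ) : ℕ∞) ≤ (u ^ (d + 1) * g).order :=
    h1.trans (le_self_add.trans MvPowerSeries.le_order_mul)
  refine lt_of_lt_of_le ?_ h2
  exact_mod_cast Nat.lt_succ_of_le hn

/-! ### The exponential of zeta sums as a limit of finite products. -/

/-- `∑_{2 ≤ k ≤ d} (x ^ k + y ^ k - (x + y) ^ k) / k * z_k`, where `z_k` is the value at `k - 2`. -/
noncomputable def realExponent (z : ℕ → ℝ) (d : ℕ) : BiSeries :=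
  ∑ k ∈ Finset.Icc 2 d, MvPowerSeries.C (1 / (k : ℝ) * z (k - 2)) *
    (MvPowerSeries.X 0 ^ k + MvPowerSeries.X 1 ^ k - (MvPowerSeries.X 0 + MvPowerSeries.X 1) ^ k)

/-- The partial sum up to the power `d` of the exponential series. -/
noncomputable def truncExp (d : ℕ) (f : BiSeries) : BiSeries :=
  ∑ j ∈ Finset.range (d + 1), MvPowerSeries.C (1 / (j.factorial : ℝ)) * f ^ j

/-- Arbitrary values `z` are allowed so that the polynomial can be evaluated at partial sums of the
zeta series before passing to the limit. -/
theorem aeval_heightOneMZVPoly (z : ℕ → ℝ) (a b : ℕ) :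
    MvPolynomial.aeval z (heightOneMZVPoly a b) =
      -MvPowerSeries.coeff (biExp a b) (truncExp (a + b) (realExponent z (a + b))) := by
  set φ : ZetaPoly →+* ℝ := ((MvPolynomial.aeval z : ZetaPoly →ₐ[ℚ] ℝ) : ZetaPoly →+* ℝ) with hφ
  have hC : ∀ q : ℚ, φ (MvPolynomial.C q) = (q : ℝ) := fun q => by simp [hφ]
  have hX : ∀ k : ℕ, φ (MvPolynomial.X k) = z k := fun k => by simp [hφ]
  set ψ : MvPolynomial (Fin 2) ZetaPoly →+* BiSeries :=
    (MvPolynomial.coeToMvPowerSeries.ringHom (σ := Fin 2) (R := ℝ)).comp (MvPolynomial.map φ)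
    with hψ
  have hψC : ∀ p, ψ (MvPolynomial.C p) = MvPowerSeries.C (φ p) := fun p => by simp [hψ]
  have hψX : ∀ i, ψ (MvPolynomial.X i) = MvPowerSeries.X i := fun i => by simp [hψ]
  have hcoeff : ∀ (n : Fin 2 →₀ ℕ) (p : MvPolynomial (Fin 2) ZetaPoly),
      φ (MvPolynomial.coeff n p) = MvPowerSeries.coeff n (ψ p) := fun n p => by
    simp [hψ, MvPolynomial.coeff_map]
  have hE : ψ (zetaExponent (a + b)) = realExponent z (a + b) := by
    simp only [zetaExponent, realExponent, map_sum, map_mul, map_sub, map_add, map_pow, hψC, hψX,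
      hC, hX]
    push_cast
    rfl
  change φ (heightOneMZVPoly a b) = _
  rw [heightOneMZVPoly, map_neg, hcoeff, map_sum]
  simp only [map_mul, map_pow, hψC, hC, hE, truncExp, biExp]
  push_cast
  rfl

theorem constantCoeff_realExponent (z : ℕ → ℝ) (d : ℕ) :
    MvPowerSeries.constantCoeff (realExponent z d) = 0 := by
  rw [realExponent, map_sum]
  refine Finset.sum_eq_zero fun k hk => ?_
  have : k ≠ 0 := by have := (Finset.mem_Icc.1 hk).1; omega
  simp [this]

theorem eulerDeriv_realExponent (z : ℕ → ℝ) (d : ℕ) :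
    eulerDeriv (realExponent z d) = ∑ k ∈ Finset.Icc 2 d, MvPowerSeries.C (z (k - 2)) *
      (MvPowerSeries.X 0 ^ k + MvPowerSeries.X 1 ^ k -
        (MvPowerSeries.X 0 + MvPowerSeries.X 1) ^ k) := by
  rw [realExponent, map_sum]
  refine Finset.sum_congr rfl fun k hk => ?_
  have hk0 : (k : ℝ) ≠ 0 := Nat.cast_ne_zero.2 (by have := (Finset.mem_Icc.1 hk).1; omega)
  rw [eulerDeriv_C_mul, map_sub, map_add, eulerDeriv_pow (eulerDeriv_X 0),
    eulerDeriv_pow (eulerDeriv_X 1), eulerDeriv_pow (by simp only [map_add, eulerDeriv_X]),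
    ← mul_add, ← mul_sub, ← mul_assoc]
  congr 1
  rw [← map_natCast (MvPowerSeries.C (σ := Fin 2) (R := ℝ)), ← map_mul]
  congr 1
  field_simp

/-- The truncated exponential satisfies the equation of `exp f` up to an error of order greater than
`d` when `f` has no constant term. -/
theorem eulerDeriv_truncExp (d : ℕ) (f : BiSeries) :
    eulerDeriv (truncExp d f) = eulerDeriv f * truncExp d f +
      -(MvPowerSeries.C (1 / (d.factorial : ℝ)) * (f ^ d * eulerDeriv f)) := by
  induction d with
  | zero => simp [truncExp]
  | succ d ih =>
    rw [truncExp, Finset.sum_range_succ, ← truncExp, map_add, ih, eulerDeriv_C_mul,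
      Derivation.leibniz_pow]
    have h1 : (MvPowerSeries.C (1 / ((d + 1).factorial : ℝ)) : BiSeries) * ((d + 1 : ℕ) : BiSeries)
        = MvPowerSeries.C (1 / (d.factorial : ℝ)) := by
      rw [← map_natCast (MvPowerSeries.C (σ := Fin 2) (R := ℝ)), ← map_mul]
      congr 1
      rw [Nat.factorial_succ]
      push_cast
      have h2 : (d.factorial : ℝ) ≠ 0 := by exact_mod_cast d.factorial_ne_zero
      have h3 : (d : ℝ) + 1 ≠ 0 := by positivity
      field_simp
    rw [Nat.add_sub_cancel, smul_eq_mul, nsmul_eq_mul, ← h1]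
    ring

/-- The factor `(1 - (x + y) / l) / ((1 - x / l) * (1 - y / l))`, with `l = i + 1`. -/
noncomputable def gammaFactor (i : ℕ) : BiSeries :=
  (1 - MvPowerSeries.C (1 / ((i : ℝ) + 1)) * (MvPowerSeries.X 0 + MvPowerSeries.X 1)) *
    ((1 - MvPowerSeries.C (1 / ((i : ℝ) + 1)) * MvPowerSeries.X 0)⁻¹ *
      (1 - MvPowerSeries.C (1 / ((i : ℝ) + 1)) * MvPowerSeries.X 1)⁻¹)

/-- The product `∏_{l ≤ N} (1 - (x + y) / l) / ((1 - x / l) * (1 - y / l))`. -/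
noncomputable def gammaProd (N : ℕ) : BiSeries := ∏ i ∈ Finset.range N, gammaFactor i

/-- The partial sums of the values `ζ(k + 2)`. -/
noncomputable def partialZeta (N k : ℕ) : ℝ := ∑ i ∈ Finset.range N, 1 / ((i : ℝ) + 1) ^ (k + 2)

theorem one_sub_mul_inv {u : BiSeries} (hu : MvPowerSeries.constantCoeff u = 0) :
    (1 - u) * (1 - u)⁻¹ = 1 :=
  MvPowerSeries.mul_inv_cancel _ (by simp [hu])

theorem eulerDeriv_one_sub {u : BiSeries} (hu : MvPowerSeries.constantCoeff u = 0)
    (hD : eulerDeriv u = u) :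
    eulerDeriv (1 - u) = -(u * (1 - u)⁻¹) * (1 - u) := by
  have h := one_sub_mul_inv hu
  rw [map_sub, Derivation.map_one_eq_zero, hD, zero_sub]
  linear_combination u * h

theorem eulerDeriv_one_sub_inv {u : BiSeries} (hu : MvPowerSeries.constantCoeff u = 0)
    (hD : eulerDeriv u = u) :
    eulerDeriv (1 - u)⁻¹ = u * (1 - u)⁻¹ * (1 - u)⁻¹ := by
  have h := one_sub_mul_inv hu
  rw [mul_comm] at h
  rw [Derivation.leibniz_of_mul_eq_one _ h, map_sub, Derivation.map_one_eq_zero, hD, zero_sub,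
    smul_eq_mul]
  ring

theorem eulerDeriv_mul_of_eq {a b f g : BiSeries} (hf : eulerDeriv f = a * f)
    (hg : eulerDeriv g = b * g) : eulerDeriv (f * g) = (a + b) * (f * g) := by
  rw [Derivation.leibniz, hf, hg, smul_eq_mul, smul_eq_mul]
  ring

theorem mul_one_sub_inv_eq_geom {u : BiSeries} (hu : MvPowerSeries.constantCoeff u = 0) (d : ℕ) :
    u * (1 - u)⁻¹ = ∑ k ∈ Finset.Icc 1 d, u ^ k + u ^ (d + 1) * (1 - u)⁻¹ := by
  induction d with
  | zero => simp
  | succ d ih =>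
    rw [ih, Finset.sum_Icc_succ_top (by omega)]
    linear_combination u ^ (d + 1) * one_sub_mul_inv hu

/-- The logarithmic Euler derivative of `gammaFactor i`. -/
noncomputable def gammaFactorLogDeriv (i : ℕ) : BiSeries :=
  -(MvPowerSeries.C (1 / ((i : ℝ) + 1)) * (MvPowerSeries.X 0 + MvPowerSeries.X 1) *
      (1 - MvPowerSeries.C (1 / ((i : ℝ) + 1)) * (MvPowerSeries.X 0 + MvPowerSeries.X 1))⁻¹) +
    (MvPowerSeries.C (1 / ((i : ℝ) + 1)) * MvPowerSeries.X 0 *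
        (1 - MvPowerSeries.C (1 / ((i : ℝ) + 1)) * MvPowerSeries.X 0)⁻¹ +
      MvPowerSeries.C (1 / ((i : ℝ) + 1)) * MvPowerSeries.X 1 *
        (1 - MvPowerSeries.C (1 / ((i : ℝ) + 1)) * MvPowerSeries.X 1)⁻¹)

theorem eulerDeriv_gammaFactor (i : ℕ) :
    eulerDeriv (gammaFactor i) = gammaFactorLogDeriv i * gammaFactor i :=
  eulerDeriv_mul_of_eq
    (eulerDeriv_one_sub (by simp) (by simp only [eulerDeriv_C_mul, map_add, eulerDeriv_X]))
    (eulerDeriv_mul_of_eq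
      (eulerDeriv_one_sub_inv (by simp) (by rw [eulerDeriv_C_mul, eulerDeriv_X]))
      (eulerDeriv_one_sub_inv (by simp) (by rw [eulerDeriv_C_mul, eulerDeriv_X])))

theorem eulerDeriv_gammaProd (N : ℕ) :
    eulerDeriv (gammaProd N) = (∑ i ∈ Finset.range N, gammaFactorLogDeriv i) * gammaProd N := by
  induction N with
  | zero => simp [gammaProd]
  | succ N ih =>
    rw [gammaProd, Finset.prod_range_succ, Finset.sum_range_succ]
    exact eulerDeriv_mul_of_eq ih (eulerDeriv_gammaFactor N)

/-- Expand the three fractions as geometric series; the tails have order greater than `d`. -/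
theorem coeff_gammaFactorLogDeriv (i : ℕ) {d : ℕ} {n : Fin 2 →₀ ℕ} (hn : n.degree ≤ d) :
    MvPowerSeries.coeff n (gammaFactorLogDeriv i - ∑ k ∈ Finset.Icc 2 d,
      MvPowerSeries.C (1 / ((i : ℝ) + 1) ^ k) * (MvPowerSeries.X 0 ^ k + MvPowerSeries.X 1 ^ k -
        (MvPowerSeries.X 0 + MvPowerSeries.X 1) ^ k)) = 0 := by
  set c : BiSeries := MvPowerSeries.C (1 / ((i : ℝ) + 1)) with hc
  have hu : MvPowerSeries.constantCoeff (c * MvPowerSeries.X 0) = 0 := by simp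
  have hv : MvPowerSeries.constantCoeff (c * MvPowerSeries.X 1) = 0 := by simp
  have hw : MvPowerSeries.constantCoeff (c * (MvPowerSeries.X 0 + MvPowerSeries.X 1)) = 0 := by
    simp
  have h1 : ∑ k ∈ Finset.Icc 2 d, MvPowerSeries.C (1 / ((i : ℝ) + 1) ^ k) *
        ((MvPowerSeries.X 0 : BiSeries) ^ k + MvPowerSeries.X 1 ^ k -
        (MvPowerSeries.X 0 + MvPowerSeries.X 1) ^ k) =
      ∑ k ∈ Finset.Icc 1 d, ((c * MvPowerSeries.X 0) ^ k + (c * MvPowerSeries.X 1) ^ k -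
        (c * (MvPowerSeries.X 0 + MvPowerSeries.X 1)) ^ k) := by
    rw [← Finset.sum_subset (Finset.Icc_subset_Icc_left (by norm_num : 1 ≤ 2))]
    · refine Finset.sum_congr rfl fun k _ => ?_
      rw [mul_pow, mul_pow, mul_pow, hc, ← map_pow, one_div_pow]
      ring
    -- The linear terms cancel, `x + y - (x + y) = 0`, so the divergent `ζ(1)` never enters.
    · intro k hk hk'
      have : k = 1 := by
        rw [Finset.mem_Icc] at hk hk'
        omega
      subst this
      ring
  rw [h1, Finset.sum_sub_distrib, Finset.sum_add_distrib]
  have h2 : gammaFactorLogDeriv i -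
      (∑ k ∈ Finset.Icc 1 d, (c * MvPowerSeries.X 0) ^ k +
        ∑ k ∈ Finset.Icc 1 d, (c * MvPowerSeries.X 1) ^ k -
        ∑ k ∈ Finset.Icc 1 d, (c * (MvPowerSeries.X 0 + MvPowerSeries.X 1)) ^ k) =
      (c * MvPowerSeries.X 0) ^ (d + 1) * (1 - c * MvPowerSeries.X 0)⁻¹ +
      (c * MvPowerSeries.X 1) ^ (d + 1) * (1 - c * MvPowerSeries.X 1)⁻¹ -
      (c * (MvPowerSeries.X 0 + MvPowerSeries.X 1)) ^ (d + 1) *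
        (1 - c * (MvPowerSeries.X 0 + MvPowerSeries.X 1))⁻¹ := by
    simp only [gammaFactorLogDeriv, ← hc]
    rw [mul_one_sub_inv_eq_geom hu d, mul_one_sub_inv_eq_geom hv d, mul_one_sub_inv_eq_geom hw d]
    ring
  rw [h2, map_sub, map_add, coeff_eq_zero_of_dvd hu (dvd_mul_right _ _) hn,
    coeff_eq_zero_of_dvd hv (dvd_mul_right _ _) hn, coeff_eq_zero_of_dvd hw (dvd_mul_right _ _) hn]
  ring

theorem coeff_mul_eq_zero_of_forall {d : ℕ} {f : BiSeries} (g : BiSeries)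
    (hf : ∀ n, n.degree ≤ d → MvPowerSeries.coeff n f = 0) :
    ∀ n, n.degree ≤ d → MvPowerSeries.coeff n (f * g) = 0 := by
  classical
  intro n hn
  rw [MvPowerSeries.coeff_mul]
  refine Finset.sum_eq_zero fun p hp => ?_
  rw [Finset.HasAntidiagonal.mem_antidiagonal] at hp
  have : n.degree = p.1.degree + p.2.degree := by rw [← hp, map_add]
  rw [hf p.1 (by omega), zero_mul]

theorem constantCoeff_gammaProd (N : ℕ) : MvPowerSeries.constantCoeff (gammaProd N) = 1 := by
  rw [gammaProd, map_prod]
  exact Finset.prod_eq_one fun i _ => by simp [gammaFactor, MvPowerSeries.constantCoeff_inv]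

theorem constantCoeff_truncExp (d : ℕ) {f : BiSeries} (hf : MvPowerSeries.constantCoeff f = 0) :
    MvPowerSeries.constantCoeff (truncExp d f) = 1 := by
  rw [truncExp, Finset.sum_range_succ', map_add, map_sum, Finset.sum_eq_zero]
  · simp
  · intro j _
    simp [hf]

/-- Both series have constant term `1` and satisfy the same Euler equation up to degree `d`, so
their difference vanishes to that degree. This replaces taking a logarithm of the product. -/
theorem coeff_truncExp_eq_coeff_gammaProd (N : ℕ) {d : ℕ} {n : Fin 2 →₀ ℕ} (hn : n.degree ≤ d) :
    MvPowerSeries.coeff n (truncExp d (realExponent (partialZeta N) d)) =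
      MvPowerSeries.coeff n (gammaProd N) := by
  set A := realExponent (partialZeta N) d with hA
  have hA0 : MvPowerSeries.constantCoeff A = 0 := constantCoeff_realExponent _ _
  have hDA : MvPowerSeries.constantCoeff (eulerDeriv A) = 0 := by
    rw [← MvPowerSeries.coeff_zero_eq_constantCoeff_apply, coeff_eulerDeriv]
    simp
  set L : BiSeries := ∑ i ∈ Finset.range N, gammaFactorLogDeriv i with hL
  have hLA : ∀ n, n.degree ≤ d → MvPowerSeries.coeff n (eulerDeriv A - L) = 0 := by
    intro n hn
    have h1 : eulerDeriv A - L = -∑ i ∈ Finset.range N, (gammaFactorLogDeriv i -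
        ∑ k ∈ Finset.Icc 2 d, MvPowerSeries.C (1 / ((i : ℝ) + 1) ^ k) *
          (MvPowerSeries.X 0 ^ k + MvPowerSeries.X 1 ^ k -
            (MvPowerSeries.X 0 + MvPowerSeries.X 1) ^ k)) := by
      rw [Finset.sum_sub_distrib, neg_sub, hA, eulerDeriv_realExponent, Finset.sum_comm]
      congr 1
      refine Finset.sum_congr rfl fun k hk => ?_
      have hk2 : k - 2 + 2 = k := Nat.sub_add_cancel (Finset.mem_Icc.1 hk).1
      rw [← Finset.sum_mul, partialZeta, map_sum, hk2]
    rw [h1, map_neg, map_sum, Finset.sum_eq_zero, neg_zero]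
    exact fun i _ => coeff_gammaFactorLogDeriv i hn
  refine sub_eq_zero.1 ?_
  rw [← map_sub]
  refine coeff_eq_zero_of_eulerDeriv (d := d) (a := eulerDeriv A)
    (h := truncExp d A - gammaProd N)
    (r := -(MvPowerSeries.C (1 / (d.factorial : ℝ)) * (A ^ d * eulerDeriv A)) +
      (eulerDeriv A - L) * gammaProd N) hDA ?_ ?_ ?_ n hn
  · rw [map_sub, constantCoeff_truncExp d hA0, constantCoeff_gammaProd, sub_self]
  · rw [map_sub, eulerDeriv_truncExp, eulerDeriv_gammaProd]
    ring
  · intro n hn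
    rw [map_add, coeff_mul_eq_zero_of_forall _ hLA n hn, add_zero, map_neg,
      MvPowerSeries.coeff_C_mul, neg_eq_zero]
    refine mul_eq_zero_of_right _ (MvPowerSeries.coeff_of_lt_order ?_)
    have h1 := MvPowerSeries.le_order_pow_of_constantCoeff_eq_zero d hA0
    have h2 := MvPowerSeries.one_le_order_iff_constCoeff_eq_zero.2 hDA
    have h3 : ((d + 1 : ℕ) : ℕ∞) ≤ (A ^ d * eulerDeriv A).order := by
      push_cast
      exact (add_le_add h1 h2).trans MvPowerSeries.le_order_mul
    refine lt_of_lt_of_le ?_ h3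
    exact_mod_cast Nat.lt_succ_of_le hn

theorem aeval_partialZeta_heightOneMZVPoly (N a b : ℕ) :
    MvPolynomial.aeval (partialZeta N) (heightOneMZVPoly a b) =
      -MvPowerSeries.coeff (biExp a b) (gammaProd N) := by
  rw [aeval_heightOneMZVPoly, coeff_truncExp_eq_coeff_gammaProd N (degree_biExp a b).le]

/-- The value `ζ(k + 2)`. -/
noncomputable def zetaValue (k : ℕ) : ℝ := ∑' i : ℕ, 1 / ((i : ℝ) + 1) ^ (k + 2)

theorem tendsto_partialZeta (k : ℕ) :
    Filter.Tendsto (fun N => partialZeta N k) Filter.atTop (nhds (zetaValue k)) := by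
  have h : Summable fun i : ℕ => 1 / ((i : ℝ) + 1) ^ (k + 2) := by
    have := (summable_nat_add_iff (f := fun i : ℕ => 1 / (i : ℝ) ^ (k + 2)) 1).2
      (Real.summable_one_div_nat_pow.2 (by omega))
    simpa using this
  exact h.hasSum.tendsto_sum_nat

theorem tendsto_coeff_gammaProd (n : Fin 2 →₀ ℕ) :
    Filter.Tendsto (fun N => MvPowerSeries.coeff n (gammaProd N)) Filter.atTop
      (nhds (-MvPolynomial.aeval zetaValue (heightOneMZVPoly (n 0) (n 1)))) := by
  have h1 : Continuous fun z : ℕ → ℝ =>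
      MvPolynomial.aeval z (heightOneMZVPoly (n 0) (n 1)) := by
    simp only [MvPolynomial.aeval_def, ← MvPolynomial.eval_map]
    exact MvPolynomial.continuous_eval _
  have h2 := (h1.tendsto zetaValue).comp (tendsto_pi_nhds.2 tendsto_partialZeta)
  refine h2.neg.congr fun N => ?_
  simp only [Function.comp]
  rw [aeval_partialZeta_heightOneMZVPoly, neg_neg, ← eq_biExp]

/-! ### The Beta recursion for the generating series and its limit. -/

/-- The generating series of the integrals `logIntegral n m i`. -/
noncomputable def logIntegralSeries (i : ℕ) : BiSeries := fun n => logIntegral (n 0) (n 1) i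

theorem coeff_logIntegralSeries (a b i : ℕ) :
    MvPowerSeries.coeff (biExp a b) (logIntegralSeries i) = logIntegral a b i := by
  change logIntegral (biExp a b 0) (biExp a b 1) i = _
  simp

/-- The series `(i - x) * logIntegralSeries (i - 1)`, continued to `i = 0`. -/
noncomputable def shiftedLogSeries : ℕ → BiSeries
  | 0 => (1 - MvPowerSeries.X 0 - MvPowerSeries.X 1) * logIntegralSeries 0
  | i + 1 => (MvPowerSeries.C ((i : ℝ) + 1) - MvPowerSeries.X 0) * logIntegralSeries i

theorem coeff_shiftedLogSeries_zero_succ_succ (a b : ℕ) :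
    MvPowerSeries.coeff (biExp (a + 1) (b + 1)) (shiftedLogSeries 0) =
      logIntegral (a + 1) (b + 1) 0 - logIntegral a (b + 1) 0 - logIntegral (a + 1) b 0 := by
  simp only [shiftedLogSeries, sub_mul, one_mul, map_sub, coeff_biExp_X_zero_mul_succ,
    coeff_biExp_X_one_mul_succ, coeff_logIntegralSeries]

theorem coeff_shiftedLogSeries_zero_zero_left (b : ℕ) :
    MvPowerSeries.coeff (biExp 0 b) (shiftedLogSeries 0) = if b = 0 then 1 else 0 := by
  rcases b with _ | b
  · simp only [shiftedLogSeries, sub_mul, one_mul, map_sub, coeff_biExp_X_zero_mul_zero,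
      coeff_biExp_X_one_mul_zero, coeff_logIntegralSeries]
    simp [logIntegral_zero_zero]
  · simp only [shiftedLogSeries, sub_mul, one_mul, map_sub, coeff_biExp_X_zero_mul_zero,
      coeff_biExp_X_one_mul_succ, coeff_logIntegralSeries]
    rw [logIntegral_swap 0, logIntegral_swap 0, logIntegral_zero_right, logIntegral_zero_right]
    simp

theorem coeff_shiftedLogSeries_succ_succ (a b i : ℕ) :
    MvPowerSeries.coeff (biExp (a + 1) b) (shiftedLogSeries (i + 1)) =
      ((i : ℝ) + 1) * logIntegral (a + 1) b i - logIntegral a b i := by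
  simp only [shiftedLogSeries, sub_mul, map_sub, coeff_biExp_X_zero_mul_succ,
    MvPowerSeries.coeff_C_mul, coeff_logIntegralSeries]

/-- The Beta recursion `(i + 1 - x - y) B(i + 1 - x, 1 - y) = (i - x) B(i - x, 1 - y)`. At `i = 0`
the right side would be a divergent integral, and the identity holds by definition. -/
theorem shiftedLogSeries_eq (i : ℕ) :
    (MvPowerSeries.C ((i : ℝ) + 1) - MvPowerSeries.X 0 - MvPowerSeries.X 1) * logIntegralSeries i =
      shiftedLogSeries i := by
  rcases i with _ | i
  · simp [shiftedLogSeries]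
  · ext n
    rw [eq_biExp n]
    generalize n 0 = a
    generalize n 1 = b
    simp only [shiftedLogSeries, sub_mul, map_sub, MvPowerSeries.coeff_C_mul]
    rcases a with _ | a <;> rcases b with _ | b <;>
      simp only [coeff_biExp_X_zero_mul_succ, coeff_biExp_X_one_mul_succ,
        coeff_biExp_X_zero_mul_zero, coeff_biExp_X_one_mul_zero, coeff_logIntegralSeries,
        sub_zero] <;> push_cast
    · rw [logIntegral_zero_zero, logIntegral_zero_zero]
      push_cast
      field_simp
    · linear_combination logIntegral_recurrence_zero_left b i
    · have h1 := logIntegral_succ_zero_right a i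
      have h2 := logIntegral_succ_zero_right a (i + 1)
      push_cast at h2
      linear_combination h2 - h1
    · linear_combination logIntegral_recurrence a b i

theorem shiftedLogSeries_succ_mul (i : ℕ) :
    shiftedLogSeries (i + 1) * (1 - MvPowerSeries.C (1 / ((i : ℝ) + 1)) *
        (MvPowerSeries.X 0 + MvPowerSeries.X 1)) =
      shiftedLogSeries i * (1 - MvPowerSeries.C (1 / ((i : ℝ) + 1)) * MvPowerSeries.X 0) := by
  have h : (MvPowerSeries.C (1 / ((i : ℝ) + 1)) : BiSeries) * MvPowerSeries.C ((i : ℝ) + 1) = 1 := by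
    rw [← map_mul, one_div_mul_cancel (by positivity), map_one]
  rw [← shiftedLogSeries_eq i, shiftedLogSeries]
  set c : BiSeries := MvPowerSeries.C (1 / ((i : ℝ) + 1))
  set e : BiSeries := MvPowerSeries.C ((i : ℝ) + 1)
  linear_combination (logIntegralSeries i) * (-MvPowerSeries.X 1) * h

/-- The product `∏_{l ≤ N} (1 - y / l)`. -/
noncomputable def linearProd (N : ℕ) : BiSeries :=
  ∏ i ∈ Finset.range N, (1 - MvPowerSeries.C (1 / ((i : ℝ) + 1)) * MvPowerSeries.X 1)

theorem linearProd_succ (N : ℕ) : linearProd (N + 1) =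
    linearProd N * (1 - MvPowerSeries.C (1 / ((N : ℝ) + 1)) * MvPowerSeries.X 1) :=
  Finset.prod_range_succ _ _

theorem gammaProd_succ (N : ℕ) : gammaProd (N + 1) = gammaProd N * gammaFactor N :=
  Finset.prod_range_succ _ _

/-- Iterating the recursion yields `∏ (1 - (x + y) / l) / (1 - x / l)`; the factors `1 - y / l` are
split off to leave the symmetric `gammaProd N`. -/
theorem shiftedLogSeries_zero_eq (N : ℕ) :
    shiftedLogSeries 0 = shiftedLogSeries N * linearProd N * gammaProd N := by
  induction N with
  | zero => simp [linearProd, gammaProd]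
  | succ N ih =>
    rw [ih, linearProd_succ, gammaProd_succ, gammaFactor]
    have h := shiftedLogSeries_succ_mul N
    have hu : (1 - MvPowerSeries.C (1 / ((N : ℝ) + 1)) * MvPowerSeries.X 0 : BiSeries) *
        (1 - MvPowerSeries.C (1 / ((N : ℝ) + 1)) * MvPowerSeries.X 0)⁻¹ = 1 :=
      one_sub_mul_inv (by simp)
    have hv : (1 - MvPowerSeries.C (1 / ((N : ℝ) + 1)) * MvPowerSeries.X 1 : BiSeries) *
        (1 - MvPowerSeries.C (1 / ((N : ℝ) + 1)) * MvPowerSeries.X 1)⁻¹ = 1 :=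
      one_sub_mul_inv (by simp)
    set u : BiSeries := 1 - MvPowerSeries.C (1 / ((N : ℝ) + 1)) * MvPowerSeries.X 0
    set v : BiSeries := 1 - MvPowerSeries.C (1 / ((N : ℝ) + 1)) * MvPowerSeries.X 1
    set w : BiSeries := 1 - MvPowerSeries.C (1 / ((N : ℝ) + 1)) *
      (MvPowerSeries.X 0 + MvPowerSeries.X 1)
    linear_combination (-linearProd N * gammaProd N * u⁻¹ * v * v⁻¹) * h
      - shiftedLogSeries N * linearProd N * gammaProd N * (u * u⁻¹) * hv
      - shiftedLogSeries N * linearProd N * gammaProd N * hu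

theorem X_dvd_gammaProd_sub_one (N : ℕ) : (MvPowerSeries.X 0 : BiSeries) ∣ gammaProd N - 1 := by
  induction N with
  | zero => simp [gammaProd]
  | succ N ih =>
    have h : (MvPowerSeries.X 0 : BiSeries) ∣ gammaFactor N - 1 := by
      have hu : (1 - MvPowerSeries.C (1 / ((N : ℝ) + 1)) * MvPowerSeries.X 0 : BiSeries) *
          (1 - MvPowerSeries.C (1 / ((N : ℝ) + 1)) * MvPowerSeries.X 0)⁻¹ = 1 :=
        one_sub_mul_inv (by simp)
      have hv : (1 - MvPowerSeries.C (1 / ((N : ℝ) + 1)) * MvPowerSeries.X 1 : BiSeries) *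
          (1 - MvPowerSeries.C (1 / ((N : ℝ) + 1)) * MvPowerSeries.X 1)⁻¹ = 1 :=
        one_sub_mul_inv (by simp)
      rw [gammaFactor]
      set c : BiSeries := MvPowerSeries.C (1 / ((N : ℝ) + 1))
      set s : BiSeries := (1 - c * MvPowerSeries.X 0)⁻¹
      set t : BiSeries := (1 - c * MvPowerSeries.X 1)⁻¹
      refine ⟨-(c * c * MvPowerSeries.X 1) * s * t, ?_⟩
      linear_combination (1 - c * MvPowerSeries.X 1) * t * hu + hv
    rw [gammaProd_succ]
    have h2 : gammaProd N * gammaFactor N - 1 =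
        gammaProd N * (gammaFactor N - 1) + (gammaProd N - 1) := by ring
    rw [h2]
    exact dvd_add (h.mul_left _) ih

/-- At `x = 0` the product `gammaProd N` is `1` and `shiftedLogSeries 0` is `(1 - y) * ∫ (1 - t) ^
(-y) = 1`, so on pure powers of `y` the limit is already attained. -/
theorem coeff_shiftedLogSeries_mul_linearProd_zero_left (N b : ℕ) :
    MvPowerSeries.coeff (biExp 0 b) (shiftedLogSeries N * linearProd N) =
      if b = 0 then 1 else 0 := by
  obtain ⟨g, hg⟩ := X_dvd_gammaProd_sub_one N
  have h : shiftedLogSeries N * linearProd N = shiftedLogSeries 0 -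
      MvPowerSeries.X 0 * (shiftedLogSeries N * linearProd N * g) := by
    rw [shiftedLogSeries_zero_eq N]
    linear_combination (-(shiftedLogSeries N * linearProd N)) * hg
  rw [h, map_sub, coeff_biExp_X_zero_mul_zero, coeff_shiftedLogSeries_zero_zero_left, sub_zero]

theorem harmonic_cast_nonneg (N : ℕ) : (0 : ℝ) ≤ ((harmonic N : ℚ) : ℝ) := by
  exact_mod_cast (Finset.sum_nonneg fun _ _ => by positivity : 0 ≤ harmonic N)

theorem coeff_linearProd_succ_left (N a b : ℕ) :
    MvPowerSeries.coeff (biExp (a + 1) b) (linearProd N) = 0 := by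
  induction N generalizing b with
  | zero =>
    classical
    rw [linearProd, Finset.prod_range_zero, MvPowerSeries.coeff_one, if_neg]
    intro h
    have := DFunLike.congr_fun h 0
    simp at this
  | succ N ih =>
    rw [linearProd_succ, mul_sub, mul_one, map_sub, ih,
      mul_left_comm, MvPowerSeries.coeff_C_mul, mul_comm (linearProd N)]
    rcases b with _ | b
    · rw [coeff_biExp_X_one_mul_zero, mul_zero, sub_zero]
    · rw [coeff_biExp_X_one_mul_succ, ih, mul_zero, sub_zero]

theorem abs_coeff_linearProd_le (N b : ℕ) :
    |MvPowerSeries.coeff (biExp 0 b) (linearProd N)| ≤ ((harmonic N : ℚ) : ℝ) ^ b := by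
  induction N generalizing b with
  | zero =>
    classical
    rw [linearProd, Finset.prod_range_zero, MvPowerSeries.coeff_one]
    rcases b with _ | b
    · simp [biExp]
    · rw [if_neg]
      · simp
      · intro h
        have := DFunLike.congr_fun h 1
        simp at this
  | succ N ih =>
    rw [linearProd_succ, mul_sub, mul_one, map_sub,
      mul_left_comm, MvPowerSeries.coeff_C_mul, mul_comm (linearProd N)]
    rcases b with _ | b
    · rw [coeff_biExp_X_one_mul_zero, mul_zero, sub_zero]
      simpa using ih 0
    · rw [coeff_biExp_X_one_mul_succ, harmonic_succ]
      push_cast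
      set H : ℝ := ((harmonic N : ℚ) : ℝ)
      have hH : 0 ≤ H := harmonic_cast_nonneg N
      have hN : (0 : ℝ) < (N : ℝ) + 1 := by positivity
      refine (abs_sub _ _).trans ?_
      rw [abs_mul, abs_of_pos (one_div_pos.2 hN), one_div]
      have h1 := mul_le_mul_of_nonneg_left (ih b) (inv_nonneg.2 hN.le)
      have h2 : H ^ b ≤ (H + ((N : ℝ) + 1)⁻¹) ^ b :=
        pow_le_pow_left₀ hH (le_add_of_nonneg_right (inv_nonneg.2 hN.le)) b
      have h3 : 0 ≤ H + ((N : ℝ) + 1)⁻¹ := by positivity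
      calc _ ≤ H ^ (b + 1) + ((N : ℝ) + 1)⁻¹ * H ^ b := add_le_add (ih (b + 1)) h1
        _ = H ^ b * (H + ((N : ℝ) + 1)⁻¹) := by ring
        _ ≤ _ := by
          rw [pow_succ]
          exact mul_le_mul_of_nonneg_right h2 h3

/-- With at least one factor `x`, the polynomial decay of the integrals beats the powers of harmonic
numbers that bound the coefficients of `linearProd`. -/
theorem tendsto_coeff_shiftedLogSeries_mul (a b k : ℕ) :
    Filter.Tendsto (fun i : ℕ => MvPowerSeries.coeff (biExp (a + 1) b) (shiftedLogSeries (i + 1)) *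
      MvPowerSeries.coeff (biExp 0 k) (linearProd (i + 1))) Filter.atTop (nhds 0) := by
  have h := (tendsto_logIntegral_mul (a + 1) b k).add (tendsto_logIntegral_mul a b k)
  rw [add_zero] at h
  refine squeeze_zero_norm (fun i => ?_) h
  have hi : (1 : ℝ) ≤ (i : ℝ) + 1 := by simp
  have hI0 := logIntegral_nonneg (a + 1) b i
  have hI1 := logIntegral_nonneg a b i
  have hp : (1 : ℝ) ≤ ((i : ℝ) + 1) ^ a := one_le_pow₀ hi
  rw [norm_mul, Real.norm_eq_abs, Real.norm_eq_abs, coeff_shiftedLogSeries_succ_succ, ← add_mul]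
  refine mul_le_mul ?_ (abs_coeff_linearProd_le _ _) (abs_nonneg _) (by positivity)
  refine (abs_sub _ _).trans (add_le_add ?_ ?_)
  · rw [abs_of_nonneg (by positivity), pow_succ]
    exact mul_le_mul_of_nonneg_right (le_mul_of_one_le_left (by positivity) hp) hI0
  · rw [abs_of_nonneg hI1]
    exact le_mul_of_one_le_left hI1 hp

theorem tendsto_coeff_shiftedLogSeries_mul_linearProd (n : Fin 2 →₀ ℕ) :
    Filter.Tendsto (fun i : ℕ =>
        MvPowerSeries.coeff n (shiftedLogSeries (i + 1) * linearProd (i + 1)))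
      Filter.atTop (nhds (if n = 0 then 1 else 0)) := by
  classical
  by_cases h0 : n 0 = 0
  · have hn : n = biExp 0 (n 1) := by rw [← h0]; exact eq_biExp n
    have h1 : (if n = 0 then (1 : ℝ) else 0) = if n 1 = 0 then 1 else 0 := by
      refine if_congr ⟨fun h => by rw [h]; rfl, fun h => ?_⟩ rfl rfl
      rw [hn, h]
      simp [biExp]
    rw [h1, hn]
    simp only [coeff_shiftedLogSeries_mul_linearProd_zero_left, biExp_apply_one]
    exact tendsto_const_nhds
  · rw [if_neg (fun h => h0 (by rw [h]; rfl))]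
    simp only [MvPowerSeries.coeff_mul]
    rw [← Finset.sum_const_zero (s := Finset.HasAntidiagonal.antidiagonal n)]
    refine tendsto_finsetSum _ fun p hp => ?_
    rw [Finset.HasAntidiagonal.mem_antidiagonal] at hp
    rw [eq_biExp p.1, eq_biExp p.2]
    -- `linearProd` involves only `y`, so a contributing pair puts all powers of `x` into the first
    -- factor, where there is at least one.
    rcases h2 : p.2 0 with _ | a
    · have h3 : p.1 0 ≠ 0 := by
        intro h3
        have := DFunLike.congr_fun hp 0
        simp only [Finsupp.add_apply] at this
        omega
      obtain ⟨a, ha⟩ := Nat.exists_eq_succ_of_ne_zero h3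
      rw [ha]
      exact tendsto_coeff_shiftedLogSeries_mul _ _ _
    · simp only [coeff_linearProd_succ_left, mul_zero]
      exact tendsto_const_nhds

theorem coeff_shiftedLogSeries_zero (n : Fin 2 →₀ ℕ) :
    MvPowerSeries.coeff n (shiftedLogSeries 0) =
      -MvPolynomial.aeval zetaValue (heightOneMZVPoly (n 0) (n 1)) := by
  classical
  have h : Filter.Tendsto (fun _ : ℕ => MvPowerSeries.coeff n (shiftedLogSeries 0)) Filter.atTop
      (nhds (∑ p ∈ Finset.HasAntidiagonal.antidiagonal n, (if p.1 = 0 then 1 else 0) *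
        (-MvPolynomial.aeval zetaValue (heightOneMZVPoly (p.2 0) (p.2 1))))) := by
    refine (tendsto_finsetSum _ fun p _ =>
      (tendsto_coeff_shiftedLogSeries_mul_linearProd p.1).mul
        ((tendsto_coeff_gammaProd p.2).comp (Filter.tendsto_add_atTop_nat 1))).congr fun i => ?_
    rw [shiftedLogSeries_zero_eq (i + 1), MvPowerSeries.coeff_mul]
    rfl
  rw [tendsto_nhds_unique tendsto_const_nhds h, Finset.sum_eq_single (0, n)]
  · simp
  · intro p hp hne
    rw [Finset.HasAntidiagonal.mem_antidiagonal] at hp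
    rw [if_neg, zero_mul]
    intro h1
    refine hne (Prod.ext h1 ?_)
    rw [← hp, h1, zero_add]
  · intro h1
    exact absurd (Finset.HasAntidiagonal.mem_antidiagonal.2 (zero_add n)) h1

/-! ### The polynomials evaluate to the integrals. -/

theorem logIntegral_succ_succ (n m i : ℕ) :
    ((i : ℝ) + 1) * logIntegral (n + 1) (m + 1) i = logIntegral n (m + 1) i +
      ∑ j ∈ Finset.range (i + 1), logIntegral (n + 1) m j -
        MvPolynomial.aeval zetaValue (heightOneMZVPoly (n + 1) (m + 1)) := by
  induction i with
  | zero =>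
    have h := coeff_shiftedLogSeries_zero (biExp (n + 1) (m + 1))
    rw [coeff_shiftedLogSeries_zero_succ_succ, biExp_apply_zero, biExp_apply_one] at h
    simp only [CharP.cast_eq_zero, zero_add, one_mul, Finset.sum_range_one]
    linear_combination h
  | succ i ih =>
    rw [Finset.sum_range_succ]
    push_cast
    linear_combination ih + logIntegral_recurrence n m i

theorem aeval_logIntegralPoly (n m i : ℕ) :
    MvPolynomial.aeval zetaValue (logIntegralPoly n m i) = logIntegral n m i := by
  induction n generalizing m i with
  | zero =>
    rw [logIntegralPoly, MvPolynomial.aeval_C, logIntegral_zero_left]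
    simp
  | succ n ihn =>
    induction m generalizing i with
    | zero =>
      rw [logIntegralPoly, MvPolynomial.aeval_C, logIntegral_zero_right]
      simp
    | succ m ihm =>
      have h : (i : ℝ) + 1 ≠ 0 := by positivity
      rw [logIntegralPoly, map_mul, map_sub, map_add, map_sum, MvPolynomial.aeval_C, ihn]
      simp only [ihm]
      rw [← logIntegral_succ_succ]
      simp only [one_div, eq_ratCast, Rat.cast_inv, Rat.cast_add, Rat.cast_natCast, Rat.cast_one]
      field_simp

theorem zetaEval_eq (p : ZetaPoly) :
    zetaEval p = ((MvPolynomial.aeval zetaValue p : ℝ) : ℂ) := by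
  have h : zetaEval = (Complex.ofRealAm.restrictScalars ℚ).comp (MvPolynomial.aeval zetaValue) := by
    refine MvPolynomial.algHom_ext fun k => ?_
    have h1 := zeta_nat_eq_tsum_of_gt_one (k := k + 2) (by omega)
    simp only [zetaEval, MvPolynomial.aeval_X, AlgHom.comp_apply, AlgHom.restrictScalars_apply,
      Complex.ofRealAm_coe, zetaValue]
    push_cast at h1 ⊢
    rw [h1]
    have h2 : Summable fun i : ℕ => 1 / (i : ℝ) ^ (k + 2) :=
      Real.summable_one_div_nat_pow.2 (by omega)
    -- The zeta series here starts at `0`, where the term `1 / 0 ^ (k + 2)` is `0` by convention;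
    -- this removes it.
    have h3 := h2.tsum_eq_zero_add
    simp only [CharP.cast_eq_zero, ne_eq, Nat.add_eq_zero_iff, OfNat.ofNat_ne_zero, and_false,
      not_false_eq_true, zero_pow, div_zero, zero_add, Nat.cast_add, Nat.cast_one] at h3
    have h4 := congrArg (fun x : ℝ => (x : ℂ)) h3
    push_cast at h4
    exact h4
  rw [h]
  rfl

theorem toll_integrand_eq (a b c : ℕ) (x : ℝ) :
    x ^ a * (1 - x) ^ b * quicksortToll x ^ c =
      ∑ q ∈ Finset.Nat.antidiagonalTuple 3 c, ∑ j ∈ Finset.range (q 1 + b + 1),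
        ((Nat.multinomial Finset.univ q : ℝ) * ((q 1 + b).choose j : ℝ) * (-1) ^ j *
          2 ^ (q 0 + q 1) * ((-1) ^ (q 0 + q 1) * ((q 0).factorial : ℝ) * ((q 1).factorial : ℝ))) *
        (x ^ (q 0 + a + j) * logPow (q 0) x * logPow (q 1) (1 - x)) := by
  have h : quicksortToll x = ∑ i : Fin 3,
      ![2 * x * Real.log x, 2 * (1 - x) * Real.log (1 - x), 1] i := by
    simp [Fin.sum_univ_three, quicksortToll]
    ring
  rw [h, Finset.sum_pow_eq_sum_piAntidiag, Finset.piAntidiag_univ_fin_eq_antidiagonalTuple,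
    Finset.mul_sum]
  refine Finset.sum_congr rfl fun q _ => ?_
  have hlog : ∀ (n : ℕ) (y : ℝ), Real.log y ^ n = (-1) ^ n * n.factorial * logPow n y := by
    intro n y
    have h1 : (n.factorial : ℝ) ≠ 0 := by exact_mod_cast n.factorial_ne_zero
    rw [logPow, mul_assoc, mul_div_cancel₀ _ h1, ← mul_pow]
    simp
  have hb : (1 - x) ^ (q 1 + b) =
      ∑ j ∈ Finset.range (q 1 + b + 1), (-1) ^ j * x ^ j * ((q 1 + b).choose j : ℝ) := by
    rw [sub_eq_neg_add, add_pow]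
    refine Finset.sum_congr rfl fun j _ => ?_
    rw [one_pow, mul_one, neg_pow]
  have e : x ^ a * (1 - x) ^ b * ((Nat.multinomial Finset.univ q : ℝ) *
      ∏ i : Fin 3, ![2 * x * Real.log x, 2 * (1 - x) * Real.log (1 - x), 1] i ^ q i) =
      ((Nat.multinomial Finset.univ q : ℝ) * 2 ^ (q 0 + q 1) * x ^ (q 0 + a) *
        (Real.log x ^ q 0 * Real.log (1 - x) ^ q 1)) * (1 - x) ^ (q 1 + b) := by
    rw [Fin.prod_univ_three]
    simp only [Matrix.cons_val_zero, Matrix.cons_val_one, Matrix.cons_val]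
    simp only [mul_pow, pow_add, one_pow]
    ring
  rw [e, hb, Finset.mul_sum]
  refine Finset.sum_congr rfl fun j _ => ?_
  rw [hlog, hlog, pow_add x (q 0 + a) j, pow_add (-1 : ℝ)]
  ring

theorem aeval_tollIntegralPoly (a b c : ℕ) :
    MvPolynomial.aeval zetaValue (tollIntegralPoly a b c) =
      ∫ x in (0 : ℝ)..1, x ^ a * (1 - x) ^ b * quicksortToll x ^ c := by
  simp only [toll_integrand_eq]
  rw [intervalIntegral.integral_finsetSum]
  · simp only [tollIntegralPoly, map_sum]
    refine Finset.sum_congr rfl fun q _ => ?_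
    rw [intervalIntegral.integral_finsetSum]
    · refine Finset.sum_congr rfl fun j _ => ?_
      rw [intervalIntegral.integral_const_mul, map_mul, MvPolynomial.aeval_C,
        aeval_logIntegralPoly]
      simp only [eq_ratCast]
      push_cast
      rfl
    · exact fun j _ => (intervalIntegrable_logIntegrand _ _ _).const_mul _
  · intro q _
    have h := IntervalIntegrable.sum (Finset.range (q 1 + b + 1)) fun j _ =>
      (intervalIntegrable_logIntegrand (q 0) (q 1) (q 0 + a + j)).const_mul
        ((Nat.multinomial Finset.univ q : ℝ) * ((q 1 + b).choose j : ℝ) * (-1) ^ j *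
          2 ^ (q 0 + q 1) * ((-1) ^ (q 0 + q 1) * ((q 0).factorial : ℝ) * ((q 1).factorial : ℝ)))
    exact h.congr fun x _ => Finset.sum_apply _ _ _

/-! ### Existence of all moments. -/

/-- The toll is `1 - 2 h(u)` with `h` the binary entropy, and `0 ≤ h ≤ log 2 ≤ 1`. -/
theorem abs_quicksortToll_le {u : ℝ} (h0 : 0 ≤ u) (h1 : u ≤ 1) : |quicksortToll u| ≤ 1 := by
  have h2 : Real.log 2 ≤ 1 := by
    have := Real.log_two_lt_d9
    linarith
  have h3 : Real.binEntropy u ≤ Real.log 2 := Real.binEntropy_le_log_two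
  have h4 : 0 ≤ Real.binEntropy u := Real.binEntropy_nonneg h0 h1
  have h5 : quicksortToll u = 1 - 2 * Real.binEntropy u := by
    rw [quicksortToll, Real.binEntropy, Real.log_inv, Real.log_inv]
    ring
  rw [h5, abs_le]
  constructor <;> linarith

theorem measurable_quicksortToll : Measurable quicksortToll := by
  unfold quicksortToll
  fun_prop

/-- Apart from the two pure powers, every monomial of the expansion has degree at most `n` in each
variable. Hence, after integration, the error involves only lower moments. -/
theorem exists_add_add_one_pow_le (n : ℕ) : ∃ C : ℝ, 0 ≤ C ∧ ∀ x y : ℝ, 0 ≤ x → 0 ≤ y →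
    (x + y + 1) ^ (n + 1) ≤ x ^ (n + 1) + y ^ (n + 1) + C * ((1 + x) ^ n * (1 + y) ^ n) := by
  induction n with
  | zero => exact ⟨1, zero_le_one, fun x y _ _ => by simp⟩
  | succ n ih =>
    obtain ⟨C, hC0, hC⟩ := ih
    refine ⟨C + 2, by positivity, fun x y hx hy => ?_⟩
    have h1 : x ^ (n + 1) * (1 + y) ≤ (1 + x) ^ (n + 1) * (1 + y) ^ (n + 1) := by
      have h2 : 1 + y ≤ (1 + y) ^ (n + 1) := le_self_pow₀ (by linarith) (by omega)
      gcongr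
      linarith
    have h2 : y ^ (n + 1) * (1 + x) ≤ (1 + x) ^ (n + 1) * (1 + y) ^ (n + 1) := by
      have h2 : 1 + x ≤ (1 + x) ^ (n + 1) := le_self_pow₀ (by linarith) (by omega)
      rw [mul_comm ((1 + x) ^ (n + 1))]
      gcongr
      linarith
    have h3 : C * ((1 + x) ^ n * (1 + y) ^ n) * (x + y + 1) ≤
        C * ((1 + x) ^ (n + 1) * (1 + y) ^ (n + 1)) := by
      have h4 : x + y + 1 ≤ (1 + x) * (1 + y) := by nlinarith [mul_nonneg hx hy]
      calc _ ≤ C * ((1 + x) ^ n * (1 + y) ^ n) * ((1 + x) * (1 + y)) := by gcongr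
        _ = _ := by ring
    calc (x + y + 1) ^ (n + 1 + 1) = (x + y + 1) ^ (n + 1) * (x + y + 1) := pow_succ _ _
      _ ≤ (x ^ (n + 1) + y ^ (n + 1) + C * ((1 + x) ^ n * (1 + y) ^ n)) * (x + y + 1) :=
        mul_le_mul_of_nonneg_right (hC x y hx hy) (by positivity)
      _ = x ^ (n + 1 + 1) + y ^ (n + 1 + 1) + x ^ (n + 1) * (1 + y) + y ^ (n + 1) * (1 + x) +
          C * ((1 + x) ^ n * (1 + y) ^ n) * (x + y + 1) := by ring
      _ ≤ _ := by linarith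

/-- The power `z ^ (n + 1)` with one of its factors truncated at `K`. -/
noncomputable def truncPow (K : ℝ) (n : ℕ) (z : ℝ) : ℝ := min z K * z ^ n

theorem truncPow_nonneg {K : ℝ} (hK : 0 ≤ K) (n : ℕ) {z : ℝ} (hz : 0 ≤ z) : 0 ≤ truncPow K n z :=
  mul_nonneg (le_min hz hK) (pow_nonneg hz n)

theorem truncPow_mono {K : ℝ} (hK : 0 ≤ K) (n : ℕ) {z w : ℝ} (hz : 0 ≤ z) (h : z ≤ w) :
    truncPow K n z ≤ truncPow K n w :=
  mul_le_mul (min_le_min_right K h) (pow_le_pow_left₀ hz h n) (pow_nonneg hz n)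
    (le_min (hz.trans h) hK)

/-- The truncated factor gives up its `u`; the remaining `u ^ n` suffices for a contraction once `n
≥ 2`. -/
theorem truncPow_mul_le (K : ℝ) (n : ℕ) {u z : ℝ} (hu : 0 ≤ u) (hu1 : u ≤ 1)
    (hz : 0 ≤ z) : truncPow K n (u * z) ≤ u ^ n * truncPow K n z := by
  have h : truncPow K n (u * z) ≤ min z K * (u * z) ^ n :=
    mul_le_mul_of_nonneg_right (min_le_min_right K (mul_le_of_le_one_left hz hu1)) (by positivity)
  refine h.trans (le_of_eq ?_)
  rw [truncPow, mul_pow]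
  ring

theorem exists_truncPow_add_le (n : ℕ) : ∃ C : ℝ, 0 ≤ C ∧ ∀ K x y : ℝ, 0 ≤ K → 0 ≤ x → 0 ≤ y →
    truncPow K (n + 1) (x + y + 1) ≤ truncPow K (n + 1) x + truncPow K (n + 1) y +
      C * ((1 + x) ^ (n + 1) * (1 + y) ^ (n + 1)) := by
  obtain ⟨C, hC0, hC⟩ := exists_add_add_one_pow_le n
  refine ⟨C + 2, by positivity, fun K x y hK hx hy => ?_⟩
  -- Truncation is subadditive, and the cross terms this creates still have degree at most `n + 1`
  -- in each variable.
  have hm : min (x + y + 1) K ≤ min x K + min y K + 1 := by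
    rcases le_total x K with h1 | h1 <;> rcases le_total y K with h2 | h2 <;>
      simp only [h1, h2, min_eq_left, min_eq_right]
    · exact min_le_left _ _
    · exact (min_le_right _ _).trans (by linarith)
    · exact (min_le_right _ _).trans (by linarith)
    · exact (min_le_right _ _).trans (by linarith)
  have hm0 : 0 ≤ min (x + y + 1) K := le_min (by positivity) hK
  have hmx : min x K ≤ x := min_le_left _ _
  have hmy : min y K ≤ y := min_le_left _ _
  have hm1 : min (x + y + 1) K ≤ (1 + x) * (1 + y) :=
    (min_le_left _ _).trans (by nlinarith [mul_nonneg hx hy])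
  have e1 : (1 + y) * x ^ (n + 1) ≤ (1 + x) ^ (n + 1) * (1 + y) ^ (n + 1) := by
    have h2 : 1 + y ≤ (1 + y) ^ (n + 1) := le_self_pow₀ (by linarith) (by omega)
    rw [mul_comm]
    gcongr
    linarith
  have e2 : (1 + x) * y ^ (n + 1) ≤ (1 + x) ^ (n + 1) * (1 + y) ^ (n + 1) := by
    have h2 : 1 + x ≤ (1 + x) ^ (n + 1) := le_self_pow₀ (by linarith) (by omega)
    gcongr
    linarith
  have e3 : min (x + y + 1) K * (C * ((1 + x) ^ n * (1 + y) ^ n)) ≤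
      C * ((1 + x) ^ (n + 1) * (1 + y) ^ (n + 1)) := by
    calc _ ≤ (1 + x) * (1 + y) * (C * ((1 + x) ^ n * (1 + y) ^ n)) := by gcongr
      _ = _ := by ring
  have f1 : min (x + y + 1) K * x ^ (n + 1) ≤
      truncPow K (n + 1) x + (1 + y) * x ^ (n + 1) := by
    rw [truncPow, ← add_mul]
    gcongr
    linarith
  have f2 : min (x + y + 1) K * y ^ (n + 1) ≤
      truncPow K (n + 1) y + (1 + x) * y ^ (n + 1) := by
    rw [truncPow, ← add_mul]
    gcongr
    linarith
  have f3 : truncPow K (n + 1) (x + y + 1) ≤ min (x + y + 1) K *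
      (x ^ (n + 1) + y ^ (n + 1) + C * ((1 + x) ^ n * (1 + y) ^ n)) :=
    mul_le_mul_of_nonneg_left (hC x y hx hy) hm0
  rw [mul_add, mul_add] at f3
  linarith

theorem measurable_truncPow (K : ℝ) (n : ℕ) : Measurable (truncPow K n) :=
  (measurable_id.min measurable_const).mul (measurable_id.pow_const n)

theorem integral_Icc_pow (n : ℕ) : ∫ u in Set.Icc (0 : ℝ) 1, u ^ n = 1 / ((n : ℝ) + 1) := by
  rw [MeasureTheory.integral_Icc_eq_integral_Ioc, ← intervalIntegral.integral_of_le zero_le_one,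
    integral_pow]
  simp

theorem integral_Icc_one_sub_pow (n : ℕ) :
    ∫ u in Set.Icc (0 : ℝ) 1, (1 - u) ^ n = 1 / ((n : ℝ) + 1) := by
  rw [MeasureTheory.integral_Icc_eq_integral_Ioc, ← intervalIntegral.integral_of_le zero_le_one,
    intervalIntegral.integral_comp_sub_left (fun u : ℝ => u ^ n), integral_pow]
  simp

/-- The map whose image measure defines the Quicksort fixed point equation. -/
noncomputable def quicksortMap (p : ℝ × ℝ × ℝ) : ℝ :=
  p.1 * p.2.1 + (1 - p.1) * p.2.2 + quicksortToll p.1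

theorem measurable_quicksortMap : Measurable quicksortMap := by
  have := measurable_quicksortToll
  unfold quicksortMap
  fun_prop

theorem abs_quicksortMap_le {p : ℝ × ℝ × ℝ} (hp : p.1 ∈ Set.Icc (0 : ℝ) 1) :
    |quicksortMap p| ≤ p.1 * |p.2.1| + (1 - p.1) * |p.2.2| + 1 := by
  refine (abs_add_three _ _ _).trans ?_
  rw [abs_mul, abs_mul, abs_of_nonneg hp.1, abs_of_nonneg (sub_nonneg.2 hp.2)]
  gcongr
  exact abs_quicksortToll_le hp.1 hp.2

/-- The joint law of `(U, Z₁, Z₂)`. -/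
noncomputable def quicksortInput (ν : MeasureTheory.Measure ℝ) :
    MeasureTheory.Measure (ℝ × ℝ × ℝ) :=
  (MeasureTheory.volume.restrict (Set.Icc (0 : ℝ) 1)).prod (ν.prod ν)

theorem ae_quicksortInput_mem {ν : MeasureTheory.Measure ℝ} :
    ∀ᵐ p ∂quicksortInput ν, p.1 ∈ Set.Icc (0 : ℝ) 1 :=
  MeasureTheory.Measure.quasiMeasurePreserving_fst.ae
    (MeasureTheory.ae_restrict_mem measurableSet_Icc)

theorem integral_quicksortInput_mul {ν : MeasureTheory.Measure ℝ}
    [MeasureTheory.IsProbabilityMeasure ν] (f g h : ℝ → ℝ) :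
    ∫ p, f p.1 * (g p.2.1 * h p.2.2) ∂quicksortInput ν =
      (∫ u in Set.Icc (0 : ℝ) 1, f u) * ((∫ z, g z ∂ν) * ∫ z, h z ∂ν) := by
  rw [quicksortInput, MeasureTheory.integral_prod_mul f fun q : ℝ × ℝ => g q.1 * h q.2,
    MeasureTheory.integral_prod_mul]

theorem integrable_quicksortInput_mul {ν : MeasureTheory.Measure ℝ}
    [MeasureTheory.SFinite ν] {f g h : ℝ → ℝ}
    (hf : MeasureTheory.IntegrableOn f (Set.Icc (0 : ℝ) 1)) (hg : MeasureTheory.Integrable g ν)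
    (hh : MeasureTheory.Integrable h ν) :
    MeasureTheory.Integrable (fun p => f p.1 * (g p.2.1 * h p.2.2)) (quicksortInput ν) :=
  MeasureTheory.Integrable.mul_prod hf (hg.mul_prod hh)

theorem integrable_one_add_abs_pow {ν : MeasureTheory.Measure ℝ}
    [MeasureTheory.IsProbabilityMeasure ν] {n : ℕ}
    (hn : MeasureTheory.Integrable (fun z => |z| ^ n) ν) :
    MeasureTheory.Integrable (fun z => (1 + |z|) ^ n) ν := by
  refine (((MeasureTheory.integrable_const (1 : ℝ)).add hn).const_mul (2 ^ n)).mono'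
    (by fun_prop) (Filter.Eventually.of_forall fun z => ?_)
  rw [Real.norm_of_nonneg (by positivity)]
  rcases le_total |z| 1 with h | h
  · calc (1 + |z|) ^ n ≤ 2 ^ n := pow_le_pow_left₀ (by positivity) (by linarith) n
      _ ≤ _ := le_mul_of_one_le_right (by positivity)
        (le_add_of_nonneg_right (pow_nonneg (abs_nonneg z) n))
  · calc (1 + |z|) ^ n ≤ (2 * |z|) ^ n := pow_le_pow_left₀ (by positivity) (by linarith) n
      _ = 2 ^ n * |z| ^ n := mul_pow _ _ _
      _ ≤ _ := by
        refine mul_le_mul_of_nonneg_left ?_ (by positivity)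
        exact le_add_of_nonneg_left (zero_le_one : (0 : ℝ) ≤ 1)

theorem integrable_truncPow {ν : MeasureTheory.Measure ℝ} {K : ℝ} (hK : 0 ≤ K) {n : ℕ}
    (hn : MeasureTheory.Integrable (fun z => |z| ^ n) ν) :
    MeasureTheory.Integrable (fun z => truncPow K n |z|) ν := by
  refine (hn.const_mul K).mono'
    ((measurable_truncPow K n).comp measurable_norm).aestronglyMeasurable
    (Filter.Eventually.of_forall fun z => ?_)
  rw [Real.norm_of_nonneg (truncPow_nonneg hK n (abs_nonneg z))]
  exact mul_le_mul_of_nonneg_right (min_le_right _ _) (by positivity)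

theorem exists_integral_truncPow_le {ν : MeasureTheory.Measure ℝ}
    [MeasureTheory.IsProbabilityMeasure ν]
    (hfix : ν = MeasureTheory.Measure.map quicksortMap (quicksortInput ν)) {n : ℕ}
    (hn : MeasureTheory.Integrable (fun z => |z| ^ (n + 2)) ν) :
    ∃ M : ℝ, ∀ K : ℝ, 0 ≤ K → ∫ z, truncPow K (n + 2) |z| ∂ν ≤ M := by
  obtain ⟨C, hC0, hC⟩ := exists_truncPow_add_le (n + 1)
  set B : ℝ := ∫ z, (1 + |z|) ^ (n + 2) ∂ν with hB
  -- The contraction constant is `∫ (u ^ (n + 2) + (1 - u) ^ (n + 2)) = 2 / (n + 3)`. Truncation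
  -- makes the moment finite, so it can be moved to the left side.
  have hr : (0 : ℝ) < 1 - 2 / ((n : ℝ) + 3) := by
    rw [sub_pos, div_lt_one (by positivity)]
    have : (0 : ℝ) ≤ n := Nat.cast_nonneg n
    linarith
  refine ⟨C * (B * B) / (1 - 2 / ((n : ℝ) + 3)), fun K hK => ?_⟩
  set E : ℝ := ∫ z, truncPow K (n + 2) |z| ∂ν with hE
  have hb := integrable_one_add_abs_pow hn
  have hg := integrable_truncPow hK hn
  have hmeas : Measurable fun z : ℝ => truncPow K (n + 2) |z| :=
    (measurable_truncPow K (n + 2)).comp measurable_norm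
  have h1 : MeasureTheory.IntegrableOn (fun u : ℝ => u ^ (n + 2)) (Set.Icc 0 1) :=
    (continuous_pow _).integrableOn_Icc
  have h2 : MeasureTheory.IntegrableOn (fun u : ℝ => (1 - u) ^ (n + 2)) (Set.Icc 0 1) :=
    ((continuous_const.sub continuous_id).pow _).integrableOn_Icc
  have h3 : MeasureTheory.IntegrableOn (fun _ : ℝ => C) (Set.Icc (0 : ℝ) 1) :=
    continuous_const.integrableOn_Icc
  have hone : MeasureTheory.Integrable (fun _ : ℝ => (1 : ℝ)) ν := MeasureTheory.integrable_const 1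
  have i1 := integrable_quicksortInput_mul h1 hg hone
  have i2 := integrable_quicksortInput_mul h2 hone hg
  have i3 := integrable_quicksortInput_mul h3 hb hb
  have key : E ≤ ∫ p, (p.1 ^ (n + 2) * (truncPow K (n + 2) |p.2.1| * 1) +
      (1 - p.1) ^ (n + 2) * (1 * truncPow K (n + 2) |p.2.2|) +
      C * ((1 + |p.2.1|) ^ (n + 2) * (1 + |p.2.2|) ^ (n + 2))) ∂quicksortInput ν := by
    rw [hE]
    conv_lhs => rw [hfix]
    rw [MeasureTheory.integral_map measurable_quicksortMap.aemeasurable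
      hmeas.aestronglyMeasurable]
    refine MeasureTheory.integral_mono_of_nonneg (Filter.Eventually.of_forall fun p =>
      truncPow_nonneg hK _ (abs_nonneg _)) ((i1.add i2).add i3) ?_
    filter_upwards [ae_quicksortInput_mem (ν := ν)] with p hp
    have hp1 : 0 ≤ 1 - p.1 := sub_nonneg.2 hp.2
    have hx : 0 ≤ p.1 * |p.2.1| := mul_nonneg hp.1 (abs_nonneg _)
    have hy : 0 ≤ (1 - p.1) * |p.2.2| := mul_nonneg hp1 (abs_nonneg _)
    refine (truncPow_mono hK _ (abs_nonneg _) (abs_quicksortMap_le hp)).trans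
      ((hC K _ _ hK hx hy).trans ?_)
    have a1 := truncPow_mul_le K (n + 2) hp.1 hp.2 (abs_nonneg p.2.1)
    have a2 := truncPow_mul_le K (n + 2) hp1 (sub_le_self 1 hp.1) (abs_nonneg p.2.2)
    have a3 : p.1 * |p.2.1| ≤ |p.2.1| := mul_le_of_le_one_left (abs_nonneg _) hp.2
    have a4 : (1 - p.1) * |p.2.2| ≤ |p.2.2| :=
      mul_le_of_le_one_left (abs_nonneg _) (sub_le_self 1 hp.1)
    rw [mul_one, one_mul]
    gcongr
  have i12 : MeasureTheory.Integrable (fun p : ℝ × ℝ × ℝ =>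
      p.1 ^ (n + 2) * (truncPow K (n + 2) |p.2.1| * 1) +
        (1 - p.1) ^ (n + 2) * (1 * truncPow K (n + 2) |p.2.2|)) (quicksortInput ν) := i1.add i2
  rw [MeasureTheory.integral_add i12 i3, MeasureTheory.integral_add i1 i2,
    integral_quicksortInput_mul (fun u => u ^ (n + 2)) (fun z => truncPow K (n + 2) |z|) (fun _ => 1),
    integral_quicksortInput_mul (fun u => (1 - u) ^ (n + 2)) (fun _ => 1)
      (fun z => truncPow K (n + 2) |z|),
    integral_quicksortInput_mul (fun _ => C) (fun z => (1 + |z|) ^ (n + 2))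
      (fun z => (1 + |z|) ^ (n + 2)), integral_Icc_pow, integral_Icc_one_sub_pow] at key
  simp only [MeasureTheory.integral_const, MeasureTheory.probReal_univ, smul_eq_mul, mul_one,
    one_mul, MeasureTheory.measureReal_restrict_apply_univ, Real.volume_real_Icc, sub_zero,
    zero_le_one, sup_of_le_left] at key
  rw [← hE, ← hB] at key
  push_cast at key
  rw [show (n : ℝ) + 2 + 1 = n + 3 by ring] at key
  rw [le_div_iff₀ hr]
  have : 2 / ((n : ℝ) + 3) = 1 / (n + 3) + 1 / (n + 3) := by ring
  rw [this]
  linarith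

theorem tendsto_truncPow (n : ℕ) (z : ℝ) :
    Filter.Tendsto (fun K : ℕ => truncPow K n z) Filter.atTop (nhds (z ^ (n + 1))) := by
  refine tendsto_const_nhds.congr' ?_
  filter_upwards [Filter.eventually_ge_atTop ⌈z⌉₊] with K hK
  rw [truncPow, min_eq_left (Nat.ceil_le.1 hK), pow_succ']

theorem integrable_abs_pow_succ {ν : MeasureTheory.Measure ℝ}
    [MeasureTheory.IsProbabilityMeasure ν]
    (hfix : ν = MeasureTheory.Measure.map quicksortMap (quicksortInput ν)) {n : ℕ}
    (hn : MeasureTheory.Integrable (fun z => |z| ^ (n + 2)) ν) :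
    MeasureTheory.Integrable (fun z => |z| ^ (n + 3)) ν := by
  obtain ⟨M, hM⟩ := exists_integral_truncPow_le hfix hn
  refine ⟨by fun_prop, ?_⟩
  rw [MeasureTheory.hasFiniteIntegral_iff_ofReal
    (Filter.Eventually.of_forall fun z => pow_nonneg (abs_nonneg z) _)]
  have h := MeasureTheory.lintegral_tendsto_of_tendsto_of_monotone (μ := ν)
    (f := fun (K : ℕ) z => ENNReal.ofReal (truncPow K (n + 2) |z|))
    (F := fun z => ENNReal.ofReal (|z| ^ (n + 3)))
    (fun K => (((measurable_truncPow K (n + 2)).comp measurable_norm).ennreal_ofReal).aemeasurable)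
    (Filter.Eventually.of_forall fun z K L hKL => ENNReal.ofReal_le_ofReal ?_)
    (Filter.Eventually.of_forall fun z => (ENNReal.continuous_ofReal.tendsto _).comp
      (tendsto_truncPow (n + 2) |z|))
  · refine (le_of_tendsto' h fun K => ?_).trans_lt (ENNReal.ofReal_lt_top (r := M))
    rw [← MeasureTheory.ofReal_integral_eq_lintegral_ofReal
      (integrable_truncPow (Nat.cast_nonneg K) hn)
      (Filter.Eventually.of_forall fun z => truncPow_nonneg (Nat.cast_nonneg K) _ (abs_nonneg z))]
    exact ENNReal.ofReal_le_ofReal (hM K (Nat.cast_nonneg K))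
  · exact mul_le_mul_of_nonneg_right (min_le_min_left _ (Nat.cast_le.2 hKL)) (by positivity)

theorem IsQuicksortLimitLaw.integrable_abs_pow {ν : MeasureTheory.Measure ℝ}
    (hν : IsQuicksortLimitLaw ν) (n : ℕ) : MeasureTheory.Integrable (fun z => |z| ^ n) ν := by
  have := hν.isProbabilityMeasure
  have h2 : ∀ n : ℕ, MeasureTheory.Integrable (fun z => |z| ^ (n + 2)) ν := by
    intro n
    induction n with
    | zero => simpa using hν.memLp_two.integrable_sq
    | succ n ih => exact integrable_abs_pow_succ hν.fixed_point ih
  refine ((MeasureTheory.integrable_const (1 : ℝ)).add (h2 n)).mono' (by fun_prop)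
    (Filter.Eventually.of_forall fun z => ?_)
  rw [Real.norm_of_nonneg (by positivity), Pi.add_apply]
  rcases le_total |z| 1 with h | h
  · exact (pow_le_one₀ (abs_nonneg z) h).trans (le_add_of_nonneg_right (by positivity))
  · exact (pow_le_pow_right₀ h (by omega)).trans (le_add_of_nonneg_left zero_le_one)

theorem IsQuicksortLimitLaw.integrable_pow {ν : MeasureTheory.Measure ℝ}
    (hν : IsQuicksortLimitLaw ν) (n : ℕ) : MeasureTheory.Integrable (fun z : ℝ => z ^ n) ν :=
  (hν.integrable_abs_pow n).mono' (by fun_prop)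
    (Filter.Eventually.of_forall fun z => by simp)

/-! ### The moment recurrence and the conclusion. -/

theorem integrableOn_toll_integrand (a b c : ℕ) :
    MeasureTheory.IntegrableOn (fun u => u ^ a * (1 - u) ^ b * quicksortToll u ^ c)
      (Set.Icc (0 : ℝ) 1) := by
  have := measurable_quicksortToll
  refine MeasureTheory.Integrable.mono' (MeasureTheory.integrable_const (1 : ℝ))
    (by fun_prop) ?_
  filter_upwards [MeasureTheory.ae_restrict_mem measurableSet_Icc] with u hu
  have h1 : 0 ≤ 1 - u := sub_nonneg.2 hu.2
  rw [norm_mul, norm_mul, norm_pow, norm_pow, norm_pow, Real.norm_of_nonneg hu.1,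
    Real.norm_of_nonneg h1, Real.norm_eq_abs]
  exact mul_le_one₀ (mul_le_one₀ (pow_le_one₀ hu.1 hu.2) (pow_nonneg h1 _)
    (pow_le_one₀ h1 (sub_le_self 1 hu.1))) (by positivity)
    (pow_le_one₀ (abs_nonneg _) (abs_quicksortToll_le hu.1 hu.2))

theorem quicksortMap_pow (p : ℝ × ℝ × ℝ) (s : ℕ) :
    quicksortMap p ^ s = ∑ k ∈ Finset.Nat.antidiagonalTuple 3 s,
      (Nat.multinomial Finset.univ k : ℝ) *
        ((p.1 ^ k 0 * (1 - p.1) ^ k 1 * quicksortToll p.1 ^ k 2) *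
          (p.2.1 ^ k 0 * p.2.2 ^ k 1)) := by
  have h : quicksortMap p = ∑ i : Fin 3,
      ![p.1 * p.2.1, (1 - p.1) * p.2.2, quicksortToll p.1] i := by
    simp [Fin.sum_univ_three, quicksortMap]
  rw [h, Finset.sum_pow_eq_sum_piAntidiag, Finset.piAntidiag_univ_fin_eq_antidiagonalTuple]
  refine Finset.sum_congr rfl fun k _ => ?_
  rw [Fin.prod_univ_three]
  simp only [Matrix.cons_val_zero, Matrix.cons_val_one, Matrix.cons_val, mul_pow]
  ring

theorem IsQuicksortLimitLaw.moment_eq_sum {ν : MeasureTheory.Measure ℝ}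
    (hν : IsQuicksortLimitLaw ν) (s : ℕ) :
    ∫ z, z ^ s ∂ν = ∑ k ∈ Finset.Nat.antidiagonalTuple 3 s,
      (Nat.multinomial Finset.univ k : ℝ) * (∫ z, z ^ k 0 ∂ν) * (∫ z, z ^ k 1 ∂ν) *
        ∫ u in (0 : ℝ)..1, u ^ k 0 * (1 - u) ^ k 1 * quicksortToll u ^ k 2 := by
  have := hν.isProbabilityMeasure
  have hfix : ν = MeasureTheory.Measure.map quicksortMap (quicksortInput ν) := hν.fixed_point
  have hi : ∀ k : Fin 3 → ℕ, MeasureTheory.Integrable (fun p : ℝ × ℝ × ℝ =>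
      (p.1 ^ k 0 * (1 - p.1) ^ k 1 * quicksortToll p.1 ^ k 2) * (p.2.1 ^ k 0 * p.2.2 ^ k 1))
      (quicksortInput ν) := fun k =>
    integrable_quicksortInput_mul (integrableOn_toll_integrand _ _ _)
      (hν.integrable_pow _) (hν.integrable_pow _)
  conv_lhs => rw [hfix]
  rw [MeasureTheory.integral_map measurable_quicksortMap.aemeasurable (by fun_prop)]
  simp only [quicksortMap_pow]
  rw [MeasureTheory.integral_finsetSum _ fun k _ => (hi k).const_mul _]
  refine Finset.sum_congr rfl fun k _ => ?_
  rw [MeasureTheory.integral_const_mul, integral_quicksortInput_mul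
    (fun u => u ^ k 0 * (1 - u) ^ k 1 * quicksortToll u ^ k 2) (fun z => z ^ k 0)
    (fun z => z ^ k 1), MeasureTheory.integral_Icc_eq_integral_Ioc,
    ← intervalIntegral.integral_of_le zero_le_one]
  ring

/-- These index triples are the ones whose term contains the moment of order `s` itself. -/
theorem filter_not_antidiagonalTuple (s : ℕ) :
    (Finset.Nat.antidiagonalTuple 3 s).filter (fun k => ¬(k 0 < s ∧ k 1 < s)) =
      {![s, 0, 0], ![0, s, 0]} := by
  ext k
  simp only [Finset.mem_filter, Finset.Nat.mem_antidiagonalTuple, Fin.sum_univ_three,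
    Finset.mem_insert, Finset.mem_singleton, funext_iff, Fin.forall_fin_succ, Fin.isValue,
    Matrix.cons_val_zero, Matrix.cons_val_succ, Fin.succ_zero_eq_one, Fin.succ_one_eq_two,
    IsEmpty.forall_iff, and_true]
  omega

theorem IsQuicksortLimitLaw.moment_recurrence {ν : MeasureTheory.Measure ℝ}
    (hν : IsQuicksortLimitLaw ν) {s : ℕ} (hs : 2 ≤ s) :
    ∫ z, z ^ s ∂ν = ((s : ℝ) + 1) / ((s : ℝ) - 1) *
      ∑ k ∈ (Finset.Nat.antidiagonalTuple 3 s).filter (fun k => k 0 < s ∧ k 1 < s),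
        (Nat.multinomial Finset.univ k : ℝ) * (∫ z, z ^ k 0 ∂ν) * (∫ z, z ^ k 1 ∂ν) *
          ∫ u in (0 : ℝ)..1, u ^ k 0 * (1 - u) ^ k 1 * quicksortToll u ^ k 2 := by
  have := hν.isProbabilityMeasure
  have h := hν.moment_eq_sum s
  rw [← Finset.sum_filter_add_sum_filter_not _ (fun k : Fin 3 → ℕ => k 0 < s ∧ k 1 < s),
    filter_not_antidiagonalTuple, Finset.sum_pair] at h
  · have h1 : Nat.multinomial Finset.univ ![s, 0, 0] = 1 := by
      simp [Nat.multinomial, Fin.sum_univ_three, Fin.prod_univ_three, Nat.div_self,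
        Nat.factorial_pos]
    have h2 : Nat.multinomial Finset.univ ![0, s, 0] = 1 := by
      simp [Nat.multinomial, Fin.sum_univ_three, Fin.prod_univ_three, Nat.div_self,
        Nat.factorial_pos]
    have h3 : ∫ u in (0 : ℝ)..1, u ^ s = 1 / ((s : ℝ) + 1) := by simp [integral_pow]
    have h4 : ∫ u in (0 : ℝ)..1, (1 - u) ^ s = 1 / ((s : ℝ) + 1) := by
      rw [intervalIntegral.integral_comp_sub_left (fun u : ℝ => u ^ s)]
      simp [integral_pow]
    rw [h1, h2] at h
    simp only [Matrix.cons_val_zero, Matrix.cons_val_one, Matrix.cons_val, pow_zero, mul_one,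
      one_mul, Nat.cast_one, h3, h4, MeasureTheory.integral_const, MeasureTheory.probReal_univ,
      smul_eq_mul] at h
    set S := ∑ k ∈ (Finset.Nat.antidiagonalTuple 3 s).filter (fun k => k 0 < s ∧ k 1 < s),
        (Nat.multinomial Finset.univ k : ℝ) * (∫ z, z ^ k 0 ∂ν) * (∫ z, z ^ k 1 ∂ν) *
          ∫ u in (0 : ℝ)..1, u ^ k 0 * (1 - u) ^ k 1 * quicksortToll u ^ k 2
    have h5 : (2 : ℝ) ≤ s := by exact_mod_cast hs
    have h6 : (s : ℝ) - 1 ≠ 0 := by linarith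
    have h7 : (s : ℝ) + 1 ≠ 0 := by positivity
    rw [div_mul_eq_mul_div, eq_div_iff h6]
    -- Here `h` reads `μ = S + 2 μ / (s + 1)`, up to arrangement.
    field_simp at h
    linear_combination h
  · intro h1
    have := congrFun h1 0
    simp at this
    omega

theorem IsQuicksortLimitLaw.aeval_momentPoly {ν : MeasureTheory.Measure ℝ}
    (hν : IsQuicksortLimitLaw ν) (s : ℕ) :
    MvPolynomial.aeval zetaValue (momentPoly s) = ∫ z, z ^ s ∂ν := by
  have := hν.isProbabilityMeasure
  induction s using Nat.strong_induction_on with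
  | _ s ih =>
    rcases lt_or_ge s 2 with hs | hs
    · interval_cases s
      · simp [momentPoly]
      · simp [momentPoly, hν.mean_eq_zero]
    · rw [momentPoly_of_two_le hs, hν.moment_recurrence hs, map_mul, map_sum, MvPolynomial.aeval_C]
      congr 1
      · simp
      · refine Finset.sum_congr rfl fun k hk => ?_
        have hk' := (Finset.mem_filter.1 hk).2
        rw [map_mul, map_mul, map_mul, MvPolynomial.aeval_C, ih _ hk'.1, ih _ hk'.2,
          aeval_tollIntegralPoly]
        simp

theorem mainTheorem11 (ν : MeasureTheory.Measure ℝ) (hν : IsQuicksortLimitLaw ν)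
    (c : ℕ → ℚ) (hc : ∀ s, c s = MvPolynomial.constantCoeff (momentPoly s)) :
    -- all moments exist, and `momentPoly s` is an expression of the `s`-th moment
    (∀ s : ℕ, MeasureTheory.Integrable (fun z : ℝ => z ^ s) ν ∧
      zetaEval (momentPoly s) = ((∫ z, z ^ s ∂ν : ℝ) : ℂ)) ∧
    -- as soon as a number can have at most one constant term, any other expression will do
    ((∀ Q : ZetaPoly, zetaEval Q = 0 → MvPolynomial.constantCoeff Q = 0) →
      ∀ (s : ℕ) (Q : ZetaPoly), zetaEval Q = ((∫ z, z ^ s ∂ν : ℝ) : ℂ) →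
        MvPolynomial.constantCoeff Q = c s) ∧
    -- the recurrence for the constant terms
    c 0 = 1 ∧ c 1 = 0 ∧
    ∀ s : ℕ, 2 ≤ s →
      c s = ((s : ℚ) + 1) / ((s : ℚ) - 1) *
        ∑ k ∈ (Finset.Nat.antidiagonalTuple 3 s).filter (fun k => k 0 < s ∧ k 1 < s),
          (Nat.multinomial Finset.univ k : ℚ) * c (k 0) * c (k 1) *
            ∑ q ∈ Finset.Nat.antidiagonalTuple 3 (k 2),
              ∑ j ∈ Finset.range (q 1 + k 1 + 1),
                (Nat.multinomial Finset.univ q : ℚ) * ((q 1 + k 1).choose j : ℚ) *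
                  (-1) ^ j * 2 ^ (q 0 + q 1) * (-1) ^ (q 0 + q 1) *
                  ((q 0).factorial : ℚ) * ((q 1).factorial : ℚ) *
                  tieredBinom (q 0) (q 1) (q 0 + k 0 + j) := by
  have hval : ∀ s : ℕ, zetaEval (momentPoly s) = ((∫ z, z ^ s ∂ν : ℝ) : ℂ) := fun s => by
    rw [zetaEval_eq, hν.aeval_momentPoly]
  refine ⟨fun s => ⟨hν.integrable_pow s, hval s⟩, fun huniq s Q hQ => ?_, ?_, ?_, fun s hs => ?_⟩
  · have h := huniq (Q - momentPoly s) (by rw [map_sub, hQ, hval, sub_self])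
    rw [map_sub, sub_eq_zero] at h
    rw [h, hc]
  · simp [hc, momentPoly]
  · simp [hc, momentPoly]
  · simp only [hc]
    exact constantCoeff_momentPoly hs
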